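/- Let $N\ge 2$, $d\ge 1$, and let $|\cdot|$ denote the max-norm. Let $(\Omega,\mathcal B,\mathbb P)$ be a probability space and $\{V(x,\omega):x\in\mathbb R^d\}$ a jointly measurable real random field such that * $V(x,\omega)\ge 0$ for all $x,\omega$, $V(\cdot,\omega)$ is locally integrable for almost every $\omega$, and there is $s_0>0$ with $-\tfrac12\ln\mathbb E[e^{-V(x,\cdot)}]\ge s_0$ for all $x\in\mathbb R^d$; * (strong mixing) there is $C_1>0$ such that for every $L>0$, all $\Lambda',\Lambda''\subset\mathbb Z^d$ with $|j-k|\ge L$ for all $j\in\Lambda'$, $k\in\Lambda''$, and all events $\mathcal E'\in\mathcal B_{\Lambda'}$, $\mathcal E''\in\mathcal B_{\Lambda''}$, $$|\mathbb P(\mathcal E'\cap\mathcal E'')-\mathbb P(\mathcal E')\,\mathbb P(\mathcal E'')|\le e^{-C_1L}.$$ Here $\mathcal B_\Lambda$ is the $\sigma$-algebra generated by the variables $V(x,\cdot)$ with $x$ in the union of the half-open unit cells centred at the points of $\Lambda$. Let $\Phi$ be a bounded measurable function on $\mathbb R$ that is non-negative on $[0,\infty)$ (only its values on $[0,\infty)$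 matter). For $1\le n\le N$, $u\in\mathbb Z^{nd}$ and $L>0$ put $C_L^{(n)}(u)=\{x\in\mathbb R^{nd}:|x-u|<L\}$, and let $E_0^{(n)}(\omega)=E_0^{(n)}(\omega;u,L)$ be the infimum of the spectrum of the Hamiltonian $$-\Delta+\sum_{1\le i<j\le n}\Phi(|x_i-x_j|)+\sum_{i=1}^nV(x_i,\omega)$$ on $L^2(C_L^{(n)}(u))$ with Dirichlet boundary conditions (the self-adjoint operator of the closure of its quadratic form on $C_c^\infty(C_L^{(n)}(u))$). Then for every $p>0$ there exists $L_1^*>0$ such that for all $1\le n\le N$, all $u\in\mathbb Z^{nd}$ and all real $L\ge L_1^*$, $$\mathbb P\bigl(E_0^{(n)}(\omega;u,L)\le L^{-1/2}\bigr)\le L^{-2p\,4^{N-n}}.$$ -/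

import Mathlib

open MeasureTheory
open scoped ENNReal ComplexConjugate

namespace MultiParticle

/-- Configurations of `n` particles in `ℝ^d`. The norm of this type is the max-norm, so
`Metric.ball u L` is the open cube of side length `2 * L` centred at `u`; the measure `volume` is
Lebesgue measure on `ℝ^(n * d)`. -/
abbrev Conf (n d : ℕ) : Type := Fin n → Fin d → ℝ

section Operator

variable {n d : ℕ}

/-- The complex Hilbert space `L²(C)`. -/
abbrev L2 (C : Set (Conf n d)) : Type := Lp ℂ 2 (volume.restrict C)

/-- `φ ∈ C_c^∞(C)`. -/
structure IsTest (C : Set (Conf n d)) (φ : Conf n d → ℂ) : Prop where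
  smooth : ContDiff ℝ ((⊤ : ℕ∞) : WithTop ℕ∞) φ
  compact : HasCompactSupport φ
  support : tsupport φ ⊆ C

/-- Partial derivative with respect to the coordinate `a.2` of particle `a.1`. -/
noncomputable def pderiv (a : Fin n × Fin d) (φ : Conf n d → ℂ) (x : Conf n d) : ℂ :=
  fderiv ℝ φ x (Pi.single a.1 (Pi.single a.2 1))

/-- `f` lies in the form domain of `-Δ + W` on `C` with Dirichlet boundary conditions, and `g` is
its weak gradient: `f` is the limit of functions in `C_c^∞(C)` with respect to the form norm
`‖∇ ·‖² + ‖·‖² + ∫ |W| |·|²`. -/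
def InFormDomain (C : Set (Conf n d)) (W : Conf n d → ℝ) (f : L2 C)
    (g : Fin n × Fin d → L2 C) : Prop :=
  ∀ ε : ℝ≥0∞, 0 < ε → ∃ φ : Conf n d → ℂ, IsTest C φ ∧
    (∫⁻ x in C, ‖φ x - f x‖ₑ ^ 2) + (∑ a, ∫⁻ x in C, ‖pderiv a φ x - g a x‖ₑ ^ 2)
      + (∫⁻ x in C, ‖W x‖ₑ * ‖φ x - f x‖ₑ ^ 2) < ε

/-- The graph of the Schrödinger operator `-Δ + W` on `L²(C)` with Dirichlet boundary conditions,
i.e. of the self-adjoint operator associated with the closure of the quadratic form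
`∫ |∇ φ|² + ∫ W |φ|²`, `φ ∈ C_c^∞(C)` (the Friedrichs extension): the pairs `(f, h)` such that `f`
is in the form domain and `-Δ f + W f = h` weakly. -/
def dirichletGraph (C : Set (Conf n d)) (W : Conf n d → ℝ) : Set (L2 C × L2 C) :=
  {q | ∃ g : Fin n × Fin d → L2 C, InFormDomain C W q.1 g ∧
    ∀ φ : Conf n d → ℂ, IsTest C φ →
      (∑ a, ∫ x in C, conj (pderiv a φ x) * g a x) + (∫ x in C, (W x : ℂ) * conj (φ x) * q.1 x)
        = ∫ x in C, conj (φ x) * q.2 x}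

end Operator

/-- The resolvent set of the (unbounded) operator with graph `A`: those `z` for which `A - z` is a
bijection from its domain onto `H` with bounded inverse `R`. -/
def resolventSetOf {H : Type*} [NormedAddCommGroup H] [NormedSpace ℂ H] (A : Set (H × H)) :
    Set ℂ :=
  {z | ∃ R : H →L[ℂ] H, (∀ q ∈ A, R (q.2 - z • q.1) = q.1) ∧ ∀ k : H, (R k, k + z • R k) ∈ A}

/-- The spectrum of the (unbounded) operator with graph `A`. -/
def spectrumOf {H : Type*} [NormedAddCommGroup H] [NormedSpace ℂ H] (A : Set (H × H)) : Set ℂ :=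
  (resolventSetOf A)ᶜ

/-- The infimum of the (real) spectrum of the operator with graph `A`, as an extended real. -/
noncomputable def spectralBottom {H : Type*} [NormedAddCommGroup H] [NormedSpace ℂ H]
    (A : Set (H × H)) : EReal :=
  ⨅ E : {E : ℝ // (E : ℂ) ∈ spectrumOf A}, ((E : ℝ) : EReal)

/-- The interaction energy `U(x) = ∑_{i < j} Φ(|x_i - x_j|)`, with the max-norm on `ℝ^d`. -/
noncomputable def interaction {n d : ℕ} (Φ : ℝ → ℝ) (x : Conf n d) : ℝ :=
  ∑ q : Fin n × Fin n with q.1 < q.2, Φ ‖x q.1 - x q.2‖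

/-- The external energy `V(x_1) + ⋯ + V(x_n)`. -/
def external {n d : ℕ} (V : (Fin d → ℝ) → ℝ) (x : Conf n d) : ℝ :=
  ∑ i, V (x i)

/-- The open cube `{x : |x - u| < L}` around the lattice point `u`. -/
def cube {n d : ℕ} (u : Fin n → Fin d → ℤ) (L : ℝ) : Set (Conf n d) :=
  Metric.ball (fun i k => (u i k : ℝ)) L

/-- The infimum of the spectrum of `-Δ + U + V` on the cube `cube u L` with Dirichlet boundary
conditions. -/
noncomputable def groundEnergy {n d : ℕ} (Φ : ℝ → ℝ) (V : (Fin d → ℝ) → ℝ)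
    (u : Fin n → Fin d → ℤ) (L : ℝ) : EReal :=
  spectralBottom (dirichletGraph (cube u L) fun x => interaction Φ x + external V x)

section RandomField

variable {d : ℕ} {Ω : Type*}

/-- The lattice point whose (half-open) unit cell contains `x`. -/
noncomputable def site (x : Fin d → ℝ) : Fin d → ℤ := fun k => round (x k)

/-- The sigma-algebra generated by the random variables `V(x)`, where `x` runs through the unit
cells around the points of `S ⊆ ℤ^d`. -/
@[reducible]
def fieldSigma (V : (Fin d → ℝ) → Ω → ℝ) (S : Set (Fin d → ℤ)) : MeasurableSpace Ω :=
  ⨆ x : {x : Fin d → ℝ // site x ∈ S}, MeasurableSpace.comap (V x) inferInstance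

/-- Rosenblatt strong mixing with an exponential rate. -/
def StronglyMixing [MeasurableSpace Ω] (P : Measure Ω) (V : (Fin d → ℝ) → Ω → ℝ) : Prop :=
  ∃ C₁ : ℝ, 0 < C₁ ∧ ∀ L : ℝ, 0 < L → ∀ S T : Set (Fin d → ℤ),
    (∀ j ∈ S, ∀ k ∈ T, L ≤ dist j k) →
    ∀ A B : Set Ω, MeasurableSet[fieldSigma V S] A → MeasurableSet[fieldSigma V T] B →
      |P.real (A ∩ B) - P.real A * P.real B| ≤ Real.exp (-C₁ * L)

end RandomField

end MultiParticle

-- Resolvent of a coercive closed form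

namespace MultiParticle

-- The bounded weight `1 - e^{-V}` lies between `0` and `V`, and the assumption on `E[e^{-V}]` gives
-- it mean at least `η = 1 - e^{-2 s₀} > 0` at every point. A single particle suffices: the
-- interaction, the potentials of the other particles and their derivatives are non-negative parts
-- of the form and can be dropped.
--
-- Deterministic part. Tile the cube of that particle by blocks of side `m`. If every block carries
-- weight at least `η / 2`, a Poincaré inequality on each block
-- (`lintegral_weight_mul_lintegral_le`) bounds the form below by a constant times `η / m^(d+2)`
-- (`one_particle_form_bound`, then `form_bound` by slicing). A form bound on test functions
-- excludes spectrum below it (`le_spectralBottom_dirichletGraph`, resting on the Lax–Milgram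
-- argument of `ofReal_mem_resolventSetOf_of_coercive`), which gives `le_groundEnergy`.
--
-- Probabilistic part. Put `k` unit cells at mutual distance at least `k` into a block of side `m =
-- k²`. Each cell has weight below `η / 2` with probability at most `1 - η / 2`, and mixing nearly
-- decouples the cells, so all of them are light with probability at most `(1 - η/2)^k + k e^{-Ck}`.
-- A union bound costs a factor of order `L^d`.
--
-- With `k = ⌊L^a⌋` and `a` small, the energy bound exceeds `L^{-1/2}` for large `L`, while the
-- probability decays faster than any power of `L`. Thus every exponent is reached, and the largest
-- one, for all `n` simultaneously.

open scoped InnerProductSpace in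
-- Lax–Milgram. The norm of `K` plays the role of the form norm, so the form shifted by `E` is
-- represented on `M` by `T = 1 - (1 + E) J* J`. Coercivity makes `T` invertible, and the resolvent
-- at `E` is `J T⁻¹ J*`.
theorem ofReal_mem_resolventSetOf_of_coercive {K H : Type*}
    [NormedAddCommGroup K] [InnerProductSpace ℂ K] [CompleteSpace K]
    [NormedAddCommGroup H] [InnerProductSpace ℂ H] [CompleteSpace H]
    (M : Submodule ℂ K) (hM : IsClosed (M : Set K)) (j : K →L[ℂ] H) (A : Set (H × H))
    (hA : ∀ f h, (f, h) ∈ A ↔ ∃ F ∈ M, j F = f ∧ ∀ G ∈ M, ⟪G, F⟫_ℂ - ⟪j G, f⟫_ℂ = ⟪j G, h⟫_ℂ)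
    {γ E : ℝ} (hγ : 0 < γ) (hE : E < γ)
    (hform : ∀ F ∈ M, (1 + γ) * ‖j F‖ ^ 2 ≤ ‖F‖ ^ 2) :
    (E : ℂ) ∈ resolventSetOf A := by
  have : CompleteSpace M := hM.completeSpace_coe
  set J : M →L[ℂ] H := j ∘L M.subtypeL with hJ
  have hJa : ∀ F : M, J F = j F := fun F => rfl
  set T : M →L[ℂ] M := 1 - ((1 + E : ℝ) : ℂ) • (J.adjoint ∘L J) with hT
  have hTi : ∀ G F : M, ⟪G, T F⟫_ℂ = ⟪G, F⟫_ℂ - ((1 + E : ℝ) : ℂ) * ⟪J G, J F⟫_ℂ := by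
    intro G F
    simp [hT, ContinuousLinearMap.adjoint_inner_right]
  have hunit : IsUnit T := by
    -- The first entry serves `1 + E ≤ 0`, where the subtracted term only helps; the second serves
    -- `1 + E > 0`, where `‖J F‖²` is replaced by its maximum `‖F‖² / (1 + γ)`.
    set c : ℝ := min 1 ((γ - E) / (1 + γ)) with hc
    have hc0 : 0 < c := lt_min one_pos (div_pos (by linarith) (by linarith))
    refine ContinuousLinearMap.isUnit_of_forall_le_norm_inner_map T (c := ⟨c, hc0.le⟩) hc0 ?_
    intro F
    have h1 : ⟪F, T F⟫_ℂ = ((‖F‖ ^ 2 - (1 + E) * ‖J F‖ ^ 2 : ℝ) : ℂ) := by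
      rw [hTi, inner_self_eq_norm_sq_to_K, inner_self_eq_norm_sq_to_K]
      simp
    have h2 : ‖⟪T F, F⟫_ℂ‖ = |‖F‖ ^ 2 - (1 + E) * ‖J F‖ ^ 2| := by
      rw [← inner_conj_symm, h1]
      simp only [Complex.conj_ofReal, Complex.norm_real, Real.norm_eq_abs]
    rw [h2]
    have h3 : (1 + γ) * ‖J F‖ ^ 2 ≤ ‖F‖ ^ 2 := hform F F.2
    refine le_trans ?_ (le_abs_self _)
    change ‖F‖ ^ 2 * c ≤ _
    rcases le_or_gt (1 + E) 0 with h | h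
    · have : c ≤ 1 := min_le_left _ _
      nlinarith [sq_nonneg ‖F‖, sq_nonneg ‖J F‖]
    · have h4 : c ≤ (γ - E) / (1 + γ) := min_le_right _ _
      have h5 : ‖J F‖ ^ 2 ≤ ‖F‖ ^ 2 / (1 + γ) := by
        rw [le_div_iff₀ (by linarith)]; linarith
      calc ‖F‖ ^ 2 * c ≤ ‖F‖ ^ 2 * ((γ - E) / (1 + γ)) := by gcongr
        _ = ‖F‖ ^ 2 - (1 + E) * (‖F‖ ^ 2 / (1 + γ)) := by
          have : (1 + γ) ≠ 0 := by linarith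
          field_simp; ring
        _ ≤ _ := by nlinarith
  obtain ⟨S, hTS, hST⟩ : ∃ S : M →L[ℂ] M, T * S = 1 ∧ S * T = 1 := by
    obtain ⟨U, hU⟩ := hunit
    exact ⟨↑U⁻¹, by simp [← hU], by simp [← hU]⟩
  refine ⟨J ∘L S ∘L J.adjoint, ?_, ?_⟩
  · rintro ⟨f, h⟩ hq
    obtain ⟨F, hF, rfl, hw⟩ := (hA f h).1 hq
    have key : T ⟨F, hF⟩ = J.adjoint (h - (E : ℂ) • j F) := by
      refine ext_inner_left ℂ fun G => ?_
      rw [hTi, ContinuousLinearMap.adjoint_inner_right, inner_sub_right, inner_smul_right]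
      have := hw G G.2
      simp only [hJa]
      rw [← this]
      push_cast
      change ⟪(G : K), F⟫_ℂ - _ = _
      ring
    have h2 : S (T ⟨F, hF⟩) = ⟨F, hF⟩ := DFunLike.congr_fun hST _
    simp only [ContinuousLinearMap.comp_apply]
    rw [← key, h2]
    rfl
  · intro k
    rw [hA]
    refine ⟨S (J.adjoint k), Submodule.coe_mem _, rfl, fun G hG => ?_⟩
    have h1 : T (S (J.adjoint k)) = J.adjoint k := DFunLike.congr_fun hTS _
    have h2 := hTi ⟨G, hG⟩ (S (J.adjoint k))
    rw [h1, ContinuousLinearMap.adjoint_inner_right] at h2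
    simp only [ContinuousLinearMap.comp_apply, inner_add_right, inner_smul_right]
    rw [← hJa ⟨G, hG⟩, h2]
    push_cast
    change ⟪G, (S (J.adjoint k) : K)⟫_ℂ - _ = ⟪G, (S (J.adjoint k) : K)⟫_ℂ - _ + _
    ring

end MultiParticle

-- The Dirichlet form domain as a closed subspace

namespace MultiParticle

open scoped InnerProductSpace

variable {n d : ℕ}

theorem IsTest.add {C : Set (Conf n d)} {φ ψ : Conf n d → ℂ} (hφ : IsTest C φ) (hψ : IsTest C ψ) :
    IsTest C (φ + ψ) where
  smooth := hφ.smooth.add hψ.smooth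
  compact := hφ.compact.add hψ.compact
  support := (tsupport_add φ ψ).trans (Set.union_subset hφ.support hψ.support)

theorem IsTest.const_smul {C : Set (Conf n d)} {φ : Conf n d → ℂ} (hφ : IsTest C φ) (c : ℂ) :
    IsTest C (c • φ) where
  smooth := contDiff_const.smul hφ.smooth
  compact := hφ.compact.smul_left (f := fun _ => c)
  support := (closure_mono (Function.support_const_smul_subset c φ)).trans hφ.support

theorem isTest_zero (C : Set (Conf n d)) : IsTest C 0 where
  smooth := contDiff_const
  compact := HasCompactSupport.zero
  support := by simp [tsupport]

theorem IsTest.differentiable {C : Set (Conf n d)} {φ : Conf n d → ℂ} (hφ : IsTest C φ) :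
    Differentiable ℝ φ :=
  hφ.smooth.differentiable (by simp)

theorem pderiv_add {φ ψ : Conf n d → ℂ} (hφ : Differentiable ℝ φ) (hψ : Differentiable ℝ ψ)
    (a : Fin n × Fin d) (x : Conf n d) : pderiv a (φ + ψ) x = pderiv a φ x + pderiv a ψ x := by
  simp [pderiv, fderiv_add (hφ x) (hψ x)]

theorem pderiv_const_smul {φ : Conf n d → ℂ} (hφ : Differentiable ℝ φ) (c : ℂ)
    (a : Fin n × Fin d) (x : Conf n d) : pderiv a (c • φ) x = c * pderiv a φ x := by
  simp [pderiv, fderiv_const_smul (hφ x)]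

theorem pderiv_zero (a : Fin n × Fin d) (x : Conf n d) :
    pderiv a (0 : Conf n d → ℂ) x = 0 := by
  simp [pderiv]

theorem IsTest.continuous_pderiv {C : Set (Conf n d)} {φ : Conf n d → ℂ} (hφ : IsTest C φ)
    (a : Fin n × Fin d) : Continuous (pderiv a φ) :=
  (hφ.smooth.continuous_fderiv (by simp)).clm_apply continuous_const

theorem IsTest.hasCompactSupport_pderiv {C : Set (Conf n d)} {φ : Conf n d → ℂ} (hφ : IsTest C φ)
    (a : Fin n × Fin d) : HasCompactSupport (pderiv a φ) :=
  hφ.compact.fderiv_apply (𝕜 := ℝ) _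

/-- The index set of the components of `(φ, √W φ, ∇ φ)`. -/
abbrev FormIndex (n d : ℕ) : Type := Option (Option (Fin n × Fin d))

/-- The Hilbert space containing the graph `(φ, √W φ, ∇ φ)` of the form domain. -/
abbrev FormSpace (C : Set (Conf n d)) : Type := PiLp 2 fun _ : FormIndex n d => L2 C

/-- The components of `(φ, √W φ, ∇ φ)`. -/
noncomputable def formComponent (W : Conf n d → ℝ) (φ : Conf n d → ℂ) :
    FormIndex n d → Conf n d → ℂ
  | none => φ
  | some none => fun x => (√(W x) : ℂ) * φ x
  | some (some a) => pderiv a φ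

/-- The graph `{(φ, √W φ, ∇ φ) : φ ∈ C_c^∞(C)}`. -/
noncomputable def testGraph (C : Set (Conf n d)) (W : Conf n d → ℝ) : Submodule ℂ (FormSpace C) where
  carrier := {F | ∃ φ, IsTest C φ ∧ ∀ i, F i =ᵐ[volume.restrict C] formComponent W φ i}
  add_mem' := by
    rintro F G ⟨φ, hφ, hF⟩ ⟨ψ, hψ, hG⟩
    refine ⟨φ + ψ, hφ.add hψ, fun i => ?_⟩
    filter_upwards [hF i, hG i, Lp.coeFn_add (F i) (G i)] with x h1 h2 h3
    rw [PiLp.add_apply, h3, Pi.add_apply, h1, h2]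
    rcases i with _ | _ | a
    · rfl
    · simp [formComponent, mul_add]
    · exact (pderiv_add hφ.differentiable hψ.differentiable a x).symm
  zero_mem' := by
    refine ⟨0, isTest_zero C, fun i => ?_⟩
    filter_upwards [Lp.coeFn_zero ℂ 2 (volume.restrict C)] with x h
    rw [PiLp.zero_apply, h]
    rcases i with _ | _ | a
    · rfl
    · simp [formComponent]
    · exact (pderiv_zero a x).symm
  smul_mem' := by
    rintro c F ⟨φ, hφ, hF⟩
    refine ⟨c • φ, hφ.const_smul c, fun i => ?_⟩
    filter_upwards [hF i, Lp.coeFn_smul c (F i)] with x h1 h3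
    rw [PiLp.smul_apply, h3, Pi.smul_apply, h1]
    rcases i with _ | _ | a
    · rfl
    · simp [formComponent]; ring
    · exact (pderiv_const_smul hφ.differentiable c a x).symm

theorem enorm_sq_eq_lintegral {α : Type*} [MeasurableSpace α] {μ : Measure α} (f : Lp ℂ 2 μ) :
    ‖f‖ₑ ^ 2 = ∫⁻ x, ‖f x‖ₑ ^ 2 ∂μ := by
  rw [Lp.enorm_def]
  have := eLpNorm_nnreal_pow_eq_lintegral (p := 2) (f := f) (μ := μ) (by norm_num)
  simpa using this

theorem enorm_sq_sub_eq_lintegral {α : Type*} [MeasurableSpace α] {μ : Measure α} (f g : Lp ℂ 2 μ) :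
    ‖f - g‖ₑ ^ 2 = ∫⁻ x, ‖f x - g x‖ₑ ^ 2 ∂μ := by
  rw [enorm_sq_eq_lintegral]
  refine lintegral_congr_ae ?_
  filter_upwards [Lp.coeFn_sub f g] with x h
  rw [h, Pi.sub_apply]

theorem formSpace_enorm_sq {C : Set (Conf n d)} (F : FormSpace C) :
    ‖F‖ₑ ^ 2 = ∑ i, ‖F i‖ₑ ^ 2 := by
  have h := PiLp.norm_sq_eq_of_L2 _ F
  simp only [← ofReal_norm]
  rw [← ENNReal.ofReal_pow (norm_nonneg _), h, ENNReal.ofReal_sum_of_nonneg (by simp)]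
  exact Finset.sum_congr rfl fun i _ => ENNReal.ofReal_pow (norm_nonneg _) 2

theorem enorm_sqrt_sq {w : ℝ} (hw : 0 ≤ w) : ‖((√w : ℝ) : ℂ)‖ₑ ^ 2 = ‖w‖ₑ := by
  rw [← enorm_pow, ← Complex.ofReal_pow, Real.sq_sqrt hw]
  simp [enorm_eq_nnnorm]

/-- The form norm of `φ - f`, where `F = (f, √W f, g)`. -/
theorem formSpace_enorm_sub_sq {C : Set (Conf n d)} {W : Conf n d → ℝ} (hW : ∀ x, 0 ≤ W x)
    {F G : FormSpace C} {φ : Conf n d → ℂ}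
    (hG : ∀ i, G i =ᵐ[volume.restrict C] formComponent W φ i)
    (hF : F (some none) =ᵐ[volume.restrict C] fun x => (√(W x) : ℂ) * F none x) :
    ‖G - F‖ₑ ^ 2 = (∫⁻ x in C, ‖φ x - F none x‖ₑ ^ 2)
      + (∑ a, ∫⁻ x in C, ‖pderiv a φ x - F (some (some a)) x‖ₑ ^ 2)
      + (∫⁻ x in C, ‖W x‖ₑ * ‖φ x - F none x‖ₑ ^ 2) := by
  rw [formSpace_enorm_sq, Fintype.sum_option, Fintype.sum_option, add_assoc]
  simp only [PiLp.sub_apply, enorm_sq_sub_eq_lintegral]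
  congr 1
  · refine lintegral_congr_ae ?_
    filter_upwards [hG none] with x h
    rw [h, formComponent]
  rw [add_comm]
  congr 1
  · refine Finset.sum_congr rfl fun a _ => lintegral_congr_ae ?_
    filter_upwards [hG (some (some a))] with x h
    rw [h, formComponent]
  · refine lintegral_congr_ae ?_
    filter_upwards [hG (some none), hF] with x h h'
    rw [h, h', formComponent, ← mul_sub, enorm_mul, mul_pow, enorm_sqrt_sq (hW x)]

theorem formComponent_memLp {C : Set (Conf n d)} {W : Conf n d → ℝ} (hWm : Measurable W)
    (hW : ∀ x, 0 ≤ W x) {φ : Conf n d → ℂ} (hφ : IsTest C φ)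
    (hWφ : ∫⁻ x in C, ‖W x‖ₑ * ‖φ x‖ₑ ^ 2 < ∞) (i : FormIndex n d) :
    MemLp (formComponent W φ i) 2 (volume.restrict C) := by
  rcases i with _ | _ | a
  · exact (hφ.smooth.continuous.memLp_of_hasCompactSupport hφ.compact).restrict C
  · refine ⟨?_, ?_⟩
    · have := hφ.smooth.continuous.measurable
      refine Measurable.aestronglyMeasurable ?_
      unfold formComponent
      fun_prop
    · have h := eLpNorm_nnreal_pow_eq_lintegral (p := 2) (f := formComponent W φ (some none))
        (μ := volume.restrict C) (by norm_num)
      have h' : ∫⁻ x in C, ‖formComponent W φ (some none) x‖ₑ ^ 2 < ∞ := by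
        simpa only [formComponent, enorm_mul, mul_pow, enorm_sqrt_sq (hW _)] using hWφ
      have h3 : eLpNorm (formComponent W φ (some none)) 2 (volume.restrict C) ^ 2 < ∞ := by
        refine lt_of_eq_of_lt ?_ h'
        simpa using h
      by_contra hcon
      rw [not_lt, top_le_iff] at hcon
      simp [hcon] at h3
  · exact ((hφ.continuous_pderiv a).memLp_of_hasCompactSupport
      (hφ.hasCompactSupport_pderiv a)).restrict C

theorem exists_formComponent_ae_eq {C : Set (Conf n d)} {W : Conf n d → ℝ} (hWm : Measurable W)
    (hW : ∀ x, 0 ≤ W x) {φ : Conf n d → ℂ} (hφ : IsTest C φ)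
    (hWφ : ∫⁻ x in C, ‖W x‖ₑ * ‖φ x‖ₑ ^ 2 < ∞) :
    ∃ G : FormSpace C, ∀ i, G i =ᵐ[volume.restrict C] formComponent W φ i :=
  ⟨WithLp.toLp 2 fun i => (formComponent_memLp hWm hW hφ hWφ i).toLp _,
    fun i => (formComponent_memLp hWm hW hφ hWφ i).coeFn_toLp⟩

theorem enorm_apply_le {C : Set (Conf n d)} (F : FormSpace C) (i : FormIndex n d) :
    ‖F i‖ₑ ≤ ‖F‖ₑ := by
  simp only [← ofReal_norm]
  exact ENNReal.ofReal_le_ofReal (PiLp.norm_apply_le F i)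

/-- Multiplication by `√W` is unbounded, so the relation does not pass to limits directly. After
damping by `b = 1 / (1 + √W)`, both `b` and `b √W` are bounded by `1`; the damped defect therefore
depends continuously on `F`, and it vanishes on test functions. -/
theorem sqrt_component_of_mem_closure {C : Set (Conf n d)} {W : Conf n d → ℝ} (hWm : Measurable W)
    {F : FormSpace C} (hF : F ∈ (testGraph C W).topologicalClosure) :
    F (some none) =ᵐ[volume.restrict C] fun x => (√(W x) : ℂ) * F none x := by
  set b : Conf n d → ℂ := fun x => (((1 + √(W x))⁻¹ : ℝ) : ℂ) with hb
  set r : Conf n d → ℂ := fun x => b x * (F (some none) x - (√(W x) : ℂ) * F none x) with hr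
  have hbm : Measurable b := by fun_prop
  have hrm : AEStronglyMeasurable r (volume.restrict C) := by
    have h1 := (Lp.aestronglyMeasurable (F (some none)))
    have h2 := (Lp.aestronglyMeasurable (F none))
    have h3 : AEStronglyMeasurable (fun x => (√(W x) : ℂ)) (volume.restrict C) := by
      refine Measurable.aestronglyMeasurable ?_
      fun_prop
    exact hbm.aestronglyMeasurable.mul (h1.sub (h3.mul h2))
  have hsmall : ∀ ε : ℝ≥0∞, 0 < ε → eLpNorm r 2 (volume.restrict C) ≤ ε + ε := by
    intro ε hε
    obtain ⟨G, ⟨φ, hφ, hG⟩, hGF⟩ := EMetric.mem_closure_iff.1 hF ε hε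
    have hle : eLpNorm r 2 (volume.restrict C) ≤
        eLpNorm (fun x => ‖(F (some none) - G (some none) : L2 C) x‖
          + ‖(F none - G none : L2 C) x‖) 2 (volume.restrict C) := by
      refine eLpNorm_mono_ae ?_
      filter_upwards [hG none, hG (some none), Lp.coeFn_sub (F none) (G none),
        Lp.coeFn_sub (F (some none)) (G (some none))] with x h1 h2 h3 h4
      rw [h3, h4, Pi.sub_apply, Pi.sub_apply, h1, h2]
      simp only [formComponent]
      have hs : 0 ≤ √(W x) := Real.sqrt_nonneg _
      have hbx : ‖b x‖ = (1 + √(W x))⁻¹ := by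
        simp only [hb, Complex.norm_real, Real.norm_eq_abs]
        exact abs_of_nonneg (by positivity)
      rw [Real.norm_of_nonneg (by positivity)]
      have : r x = b x * (F (some none) x - (√(W x) : ℂ) * φ x)
          + b x * ((√(W x) : ℂ) * -(F none x - φ x)) := by
        simp only [hr]; ring
      rw [this]
      refine (norm_add_le _ _).trans (add_le_add ?_ ?_)
      · rw [norm_mul, hbx]
        refine mul_le_of_le_one_left (norm_nonneg _) (inv_le_one_of_one_le₀ (by linarith))
      · rw [norm_mul, norm_mul, norm_neg, hbx, ← mul_assoc, Complex.norm_real,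
          Real.norm_of_nonneg hs]
        refine mul_le_of_le_one_left (norm_nonneg _) ?_
        rw [inv_mul_le_iff₀ (by linarith)]
        linarith
    refine hle.trans ((eLpNorm_add_le (Lp.aestronglyMeasurable _).norm
      (Lp.aestronglyMeasurable _).norm (by norm_num)).trans ?_)
    rw [eLpNorm_norm, eLpNorm_norm, ← Lp.enorm_def, ← Lp.enorm_def]
    rw [edist_eq_enorm_sub] at hGF
    exact add_le_add ((enorm_apply_le (F - G) _).trans hGF.le)
      ((enorm_apply_le (F - G) _).trans hGF.le)
  have hzero : eLpNorm r 2 (volume.restrict C) = 0 := by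
    refine le_antisymm (ENNReal.le_of_forall_pos_le_add fun ε hε _ => ?_) bot_le
    have := hsmall (ε / 2 : ℝ≥0∞) (by simp [hε.ne'])
    rwa [ENNReal.add_halves, ← zero_add (ε : ℝ≥0∞)] at this
  rw [eLpNorm_eq_zero_iff hrm (by norm_num)] at hzero
  filter_upwards [hzero] with x hx
  have hs : 0 ≤ √(W x) := Real.sqrt_nonneg _
  have hbx : b x ≠ 0 := by
    simp only [hb, ne_eq, Complex.ofReal_eq_zero]
    positivity
  have := (mul_eq_zero.1 hx).resolve_left hbx
  exact sub_eq_zero.1 this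

/-- The squared distance from `F` to the graph point of `φ` is exactly the form norm in
`InFormDomain`, once the middle component of `F` is known to be `√W` times the first. -/
theorem mem_closure_testGraph_iff {C : Set (Conf n d)} {W : Conf n d → ℝ} (hWm : Measurable W)
    (hW : ∀ x, 0 ≤ W x)
    (hWφ : ∀ φ, IsTest C φ → ∫⁻ x in C, ‖W x‖ₑ * ‖φ x‖ₑ ^ 2 < ∞) (F : FormSpace C) :
    F ∈ (testGraph C W).topologicalClosure ↔
      InFormDomain C W (F none) (fun a => F (some (some a))) ∧
        F (some none) =ᵐ[volume.restrict C] fun x => (√(W x) : ℂ) * F none x := by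
  constructor
  · intro hF
    have hs := sqrt_component_of_mem_closure hWm hF
    refine ⟨fun ε hε => ?_, hs⟩
    -- A distance at most `1` dominates its own square, which is what has to be below `ε`.
    obtain ⟨G, ⟨φ, hφ, hG⟩, hGF⟩ := EMetric.mem_closure_iff.1 hF (min 1 ε) (by simp [hε])
    refine ⟨φ, hφ, ?_⟩
    rw [← formSpace_enorm_sub_sq hW hG hs]
    rw [edist_comm, edist_eq_enorm_sub] at hGF
    have h1 : ‖G - F‖ₑ ≤ 1 := hGF.le.trans (min_le_left _ _)
    have h2 : ‖G - F‖ₑ < ε := hGF.trans_le (min_le_right _ _)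
    refine lt_of_le_of_lt ?_ h2
    rw [sq]
    exact mul_le_of_le_one_left' h1
  · rintro ⟨hF, hs⟩
    refine EMetric.mem_closure_iff.2 fun ε hε => ?_
    obtain ⟨φ, hφ, hlt⟩ := hF (ε ^ 2) (by positivity)
    obtain ⟨G, hG⟩ := exists_formComponent_ae_eq hWm hW hφ (hWφ φ hφ)
    rw [← formSpace_enorm_sub_sq hW hG hs] at hlt
    refine ⟨G, ⟨φ, hφ, hG⟩, ?_⟩
    rw [edist_comm, edist_eq_enorm_sub]
    exact lt_of_not_ge fun hle => hlt.not_ge (pow_le_pow_left' hle 2)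

/-- The inner product of `FormSpace` is the energy form plus the `L²` product; subtracting the
latter leaves the weak form of `-Δ + W`. -/
theorem formSpace_inner_sub {C : Set (Conf n d)} {W : Conf n d → ℝ} (hW : ∀ x, 0 ≤ W x)
    {F G : FormSpace C} {φ : Conf n d → ℂ}
    (hG : ∀ i, G i =ᵐ[volume.restrict C] formComponent W φ i)
    (hF : F (some none) =ᵐ[volume.restrict C] fun x => (√(W x) : ℂ) * F none x) :
    ⟪G, F⟫_ℂ - ⟪G none, F none⟫_ℂ =
      (∑ a, ∫ x in C, conj (pderiv a φ x) * F (some (some a)) x)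
        + (∫ x in C, (W x : ℂ) * conj (φ x) * F none x) := by
  rw [PiLp.inner_apply, Fintype.sum_option, Fintype.sum_option, add_sub_cancel_left, add_comm]
  congr 1
  · refine Finset.sum_congr rfl fun a _ => ?_
    rw [L2.inner_def]
    refine integral_congr_ae ?_
    filter_upwards [hG (some (some a))] with x h
    rw [RCLike.inner_apply', h, formComponent]
  · rw [L2.inner_def]
    refine integral_congr_ae ?_
    filter_upwards [hG (some none), hF] with x h h'
    have h2 : ((√(W x) : ℝ) : ℂ) * ((√(W x) : ℝ) : ℂ) = (W x : ℂ) := by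
      rw [← Complex.ofReal_mul, Real.mul_self_sqrt (hW x)]
    rw [RCLike.inner_apply', h, h', formComponent, map_mul, Complex.conj_ofReal, ← h2]
    ring

theorem L2_inner_eq_of_ae {C : Set (Conf n d)} {f h : L2 C} {φ : Conf n d → ℂ}
    (hf : f =ᵐ[volume.restrict C] φ) : ⟪f, h⟫_ℂ = ∫ x in C, conj (φ x) * h x := by
  rw [L2.inner_def]
  refine integral_congr_ae ?_
  filter_upwards [hf] with x h'
  rw [RCLike.inner_apply', h']

/-- Brings the operator into the shape required by the abstract resolvent lemma. The weak equation
is tested on smooth functions only; it extends to the closure because both sides are continuous in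
`G`. -/
theorem mem_dirichletGraph_iff {C : Set (Conf n d)} {W : Conf n d → ℝ} (hWm : Measurable W)
    (hW : ∀ x, 0 ≤ W x)
    (hWφ : ∀ φ, IsTest C φ → ∫⁻ x in C, ‖W x‖ₑ * ‖φ x‖ₑ ^ 2 < ∞) (f h : L2 C) :
    (f, h) ∈ dirichletGraph C W ↔ ∃ F ∈ (testGraph C W).topologicalClosure, F none = f ∧
      ∀ G ∈ (testGraph C W).topologicalClosure,
        ⟪G, F⟫_ℂ - ⟪G none, f⟫_ℂ = ⟪G none, h⟫_ℂ := by
  constructor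
  · rintro ⟨g, hg, hweak⟩
    obtain ⟨φ, hφ, hlt⟩ := hg 1 one_pos
    have hsm : AEStronglyMeasurable (fun x => (√(W x) : ℂ)) (volume.restrict C) := by
      refine Measurable.aestronglyMeasurable ?_
      fun_prop
    -- Write `√W f = √W φ - √W (φ - f)` with `φ` at finite form distance from `f`; both terms are
    -- square integrable.
    have hmem : MemLp (fun x => (√(W x) : ℂ) * f x) 2 (volume.restrict C) := by
      have h1 : MemLp (fun x => (√(W x) : ℂ) * (φ x - f x)) 2 (volume.restrict C) := by
        refine ⟨hsm.mul (hφ.smooth.continuous.aestronglyMeasurable.sub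
          (Lp.aestronglyMeasurable f)), ?_⟩
        have h := eLpNorm_nnreal_pow_eq_lintegral (p := 2)
          (f := fun x => (√(W x) : ℂ) * (φ x - f x)) (μ := volume.restrict C) (by norm_num)
        have h3 : eLpNorm (fun x => (√(W x) : ℂ) * (φ x - f x)) 2 (volume.restrict C) ^ 2 < ∞ := by
          have h' : ∫⁻ x in C, ‖W x‖ₑ * ‖φ x - f x‖ₑ ^ 2 < ∞ :=
            lt_of_le_of_lt le_add_self (hlt.trans ENNReal.one_lt_top)
          refine lt_of_eq_of_lt ?_ h'
          simpa [enorm_mul, mul_pow, enorm_sqrt_sq (hW _)] using h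
        by_contra hcon
        rw [not_lt, top_le_iff] at hcon
        simp [hcon] at h3
      have h2 := formComponent_memLp hWm hW hφ (hWφ φ hφ) (some none)
      convert h2.sub h1 using 1
      ext x
      simp only [formComponent, Pi.sub_apply]
      ring
    set F : FormSpace C := WithLp.toLp 2 fun i : FormIndex n d => match i with
      | none => f
      | some none => hmem.toLp _
      | some (some a) => g a with hFdef
    have hs : F (some none) =ᵐ[volume.restrict C] fun x => (√(W x) : ℂ) * F none x :=
      hmem.coeFn_toLp
    refine ⟨F, (mem_closure_testGraph_iff hWm hW hWφ F).2 ⟨hg, hs⟩, rfl, ?_⟩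
    have hcl : IsClosed {G : FormSpace C | ⟪G, F⟫_ℂ - ⟪G none, f⟫_ℂ = ⟪G none, h⟫_ℂ} := by
      refine isClosed_eq ?_ ?_ <;> fun_prop
    refine fun G hG => closure_minimal ?_ hcl hG
    rintro G ⟨φ, hφ, hG⟩
    have h1 := formSpace_inner_sub hW hG hs
    change ⟪G, F⟫_ℂ - ⟪G none, f⟫_ℂ = ⟪G none, h⟫_ℂ
    rw [L2_inner_eq_of_ae (h := h) (hG none)]
    exact h1.trans (hweak φ hφ)
  · rintro ⟨F, hF, rfl, hG⟩
    obtain ⟨hF1, hs⟩ := (mem_closure_testGraph_iff hWm hW hWφ F).1 hF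
    refine ⟨fun a => F (some (some a)), hF1, fun φ hφ => ?_⟩
    obtain ⟨G, hGφ⟩ := exists_formComponent_ae_eq hWm hW hφ (hWφ φ hφ)
    have h1 := hG G ((testGraph C W).le_topologicalClosure ⟨φ, hφ, hGφ⟩)
    rw [formSpace_inner_sub hW hGφ hs, L2_inner_eq_of_ae (hGφ none)] at h1
    exact h1

/-- A lower bound of the quadratic form on test functions bounds the spectrum from below. -/
theorem le_spectralBottom_dirichletGraph {C : Set (Conf n d)} {W : Conf n d → ℝ}
    (hWm : Measurable W) (hW : ∀ x, 0 ≤ W x)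
    (hWφ : ∀ φ, IsTest C φ → ∫⁻ x in C, ‖W x‖ₑ * ‖φ x‖ₑ ^ 2 < ∞) {γ : ℝ} (hγ : 0 < γ)
    (hform : ∀ φ, IsTest C φ → ENNReal.ofReal γ * ∫⁻ x in C, ‖φ x‖ₑ ^ 2 ≤
      (∑ a, ∫⁻ x in C, ‖pderiv a φ x‖ₑ ^ 2) + ∫⁻ x in C, ‖W x‖ₑ * ‖φ x‖ₑ ^ 2) :
    (γ : EReal) ≤ spectralBottom (dirichletGraph C W) := by
  refine le_iInf fun E => ?_
  rw [EReal.coe_le_coe_iff]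
  by_contra! hE
  refine E.2 (ofReal_mem_resolventSetOf_of_coercive (testGraph C W).topologicalClosure
    (testGraph C W).isClosed_topologicalClosure (PiLp.proj (𝕜 := ℂ) 2 _ none) _
    (mem_dirichletGraph_iff hWm hW hWφ) hγ hE ?_)
  -- The norm contains `‖φ‖²` besides the energy, hence the constant `1 + γ`. The inequality is a
  -- closed condition, so test functions suffice.
  have hcl : IsClosed {F : FormSpace C | (1 + γ) * ‖F none‖ ^ 2 ≤ ‖F‖ ^ 2} := by
    refine isClosed_le ?_ ?_ <;> fun_prop
  refine fun F hF => closure_minimal ?_ hcl hF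
  rintro F ⟨φ, hφ, hFφ⟩
  have hz : ∀ i, ∀ᵐ x ∂volume.restrict C, (0 : FormSpace C) i x = 0 := fun i =>
    Lp.coeFn_zero ℂ 2 (volume.restrict C)
  have h0 := formSpace_enorm_sub_sq (F := 0) hW hFφ (by
    filter_upwards [hz none, hz (some none)] with x h h'
    rw [h, h', mul_zero])
  have e1 : ∫⁻ x in C, ‖φ x - (0 : FormSpace C) none x‖ₑ ^ 2 = ∫⁻ x in C, ‖φ x‖ₑ ^ 2 :=
    lintegral_congr_ae (by filter_upwards [hz none] with x h; rw [h, sub_zero])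
  have e2 : ∀ a, ∫⁻ x in C, ‖pderiv a φ x - (0 : FormSpace C) (some (some a)) x‖ₑ ^ 2 =
      ∫⁻ x in C, ‖pderiv a φ x‖ₑ ^ 2 := fun a =>
    lintegral_congr_ae (by filter_upwards [hz (some (some a))] with x h; rw [h, sub_zero])
  have e3 : ∫⁻ x in C, ‖W x‖ₑ * ‖φ x - (0 : FormSpace C) none x‖ₑ ^ 2 =
      ∫⁻ x in C, ‖W x‖ₑ * ‖φ x‖ₑ ^ 2 :=
    lintegral_congr_ae (by filter_upwards [hz none] with x h; rw [h, sub_zero])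
  have e4 : ‖F none‖ₑ ^ 2 = ∫⁻ x in C, ‖φ x‖ₑ ^ 2 := by
    rw [enorm_sq_eq_lintegral]
    refine lintegral_congr_ae ?_
    filter_upwards [hFφ none] with x h
    rw [h, formComponent]
  rw [e1, e3, sub_zero] at h0
  simp only [e2] at h0
  have h1 : ENNReal.ofReal (1 + γ) * ‖F none‖ₑ ^ 2 ≤ ‖F‖ₑ ^ 2 := by
    rw [h0, e4, ENNReal.ofReal_add zero_le_one hγ.le, ENNReal.ofReal_one, add_mul, one_mul,
      add_assoc]
    gcongr
    exact hform φ hφ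
  simp only [← ofReal_norm] at h1
  rw [← ENNReal.ofReal_pow (norm_nonneg _), ← ENNReal.ofReal_pow (norm_nonneg _),
    ← ENNReal.ofReal_mul (by linarith), ENNReal.ofReal_le_ofReal_iff (by positivity)] at h1
  exact h1

end MultiParticle

-- Weighted Poincaré inequality on convex sets

namespace MultiParticle

open Set

theorem sq_lintegral_enorm_le {α : Type*} [MeasurableSpace α] {μ : Measure α}
    [IsProbabilityMeasure μ] {f : α → ℂ} (hf : AEStronglyMeasurable f μ) :
    (∫⁻ x, ‖f x‖ₑ ∂μ) ^ 2 ≤ ∫⁻ x, ‖f x‖ₑ ^ 2 ∂μ := by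
  have h1 := eLpNorm_le_eLpNorm_of_exponent_le (p := 1) (q := 2) (by norm_num) hf
  rw [eLpNorm_one_eq_lintegral_enorm] at h1
  have h2 := eLpNorm_nnreal_pow_eq_lintegral (p := 2) (f := f) (μ := μ) (by norm_num)
  calc (∫⁻ x, ‖f x‖ₑ ∂μ) ^ 2 ≤ eLpNorm f 2 μ ^ 2 := pow_le_pow_left' h1 2
    _ = _ := by simpa using h2

theorem enorm_add_sq_le {E : Type*} [SeminormedAddCommGroup E] (a b : E) :
    ‖a + b‖ₑ ^ 2 ≤ 2 * (‖a‖ₑ ^ 2 + ‖b‖ₑ ^ 2) := by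
  simp only [← ofReal_norm]
  rw [← ENNReal.ofReal_pow (norm_nonneg _), ← ENNReal.ofReal_pow (norm_nonneg _),
    ← ENNReal.ofReal_pow (norm_nonneg _), ← ENNReal.ofReal_add (by positivity) (by positivity),
    ← ENNReal.ofReal_ofNat 2, ← ENNReal.ofReal_mul (by norm_num)]
  refine ENNReal.ofReal_le_ofReal ?_
  have := norm_add_le a b
  nlinarith [norm_nonneg (a + b), sq_nonneg (‖a‖ - ‖b‖), norm_nonneg a, norm_nonneg b]

variable {d : ℕ}

/-- The squared length of the gradient. -/
noncomputable def gradSq (ψ : (Fin d → ℝ) → ℂ) (x : Fin d → ℝ) : ℝ≥0∞ :=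
  ∑ k, ‖fderiv ℝ ψ x (Pi.single k 1)‖ₑ ^ 2

theorem continuous_gradSq {ψ : (Fin d → ℝ) → ℂ} (hψ : ContDiff ℝ 1 ψ) :
    Continuous (gradSq ψ) := by
  refine continuous_finsetSum _ fun k _ => ?_
  have : Continuous fun x => fderiv ℝ ψ x (Pi.single k 1) :=
    (hψ.continuous_fderiv (by simp)).clm_apply continuous_const
  exact (ENNReal.continuous_pow 2).comp this.enorm

theorem enorm_fderiv_apply_sq_le (ψ : (Fin d → ℝ) → ℂ) (x v : Fin d → ℝ) {l : ℝ}
    (hv : ∀ k, |v k| ≤ l) :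
    ‖fderiv ℝ ψ x v‖ₑ ^ 2 ≤ ENNReal.ofReal (d * l ^ 2) * gradSq ψ x := by
  have h1 : ‖fderiv ℝ ψ x v‖ ≤ ∑ k, l * ‖fderiv ℝ ψ x (Pi.single k 1)‖ := by
    have : v = ∑ k, v k • (Pi.single k 1 : Fin d → ℝ) := by
      simpa using (pi_eq_sum_univ' v)
    conv_lhs => rw [this, map_sum]
    refine (norm_sum_le _ _).trans (Finset.sum_le_sum fun k _ => ?_)
    rw [map_smul, norm_smul, Real.norm_eq_abs]
    gcongr
    exact hv k
  have h2 : ‖fderiv ℝ ψ x v‖ ^ 2 ≤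
      (d * l ^ 2) * ∑ k, ‖fderiv ℝ ψ x (Pi.single k 1)‖ ^ 2 := by
    calc ‖fderiv ℝ ψ x v‖ ^ 2 ≤ (∑ k, l * ‖fderiv ℝ ψ x (Pi.single k 1)‖) ^ 2 := by gcongr
      _ ≤ (Finset.univ : Finset (Fin d)).card
            * ∑ k, (l * ‖fderiv ℝ ψ x (Pi.single k 1)‖) ^ 2 :=
          sq_sum_le_card_mul_sum_sq
      _ = _ := by simp [mul_pow, ← Finset.mul_sum, mul_assoc]
  have h3 : gradSq ψ x = ENNReal.ofReal (∑ k, ‖fderiv ℝ ψ x (Pi.single k 1)‖ ^ 2) := by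
    rw [ENNReal.ofReal_sum_of_nonneg (by simp)]
    refine Finset.sum_congr rfl fun k _ => ?_
    rw [ENNReal.ofReal_pow (norm_nonneg _), ofReal_norm]
  rw [h3, ← ENNReal.ofReal_mul (by positivity), ← ofReal_norm,
    ← ENNReal.ofReal_pow (norm_nonneg _)]
  exact ENNReal.ofReal_le_ofReal h2

/-- Fundamental theorem of calculus along the segment from `x` to `y`, followed by Cauchy–Schwarz in
`t` and in the coordinates. -/
theorem enorm_sub_sq_le_lintegral_gradSq {ψ : (Fin d → ℝ) → ℂ} (hψ : ContDiff ℝ 1 ψ)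
    (x y : Fin d → ℝ) {l : ℝ} (hxy : ∀ k, |y k - x k| ≤ l) :
    ‖ψ y - ψ x‖ₑ ^ 2 ≤
      ENNReal.ofReal (d * l ^ 2) * ∫⁻ t in Ioc (0 : ℝ) 1, gradSq ψ (x + t • (y - x)) := by
  have hderiv : ∀ t : ℝ, HasDerivAt (fun t : ℝ => ψ (x + t • (y - x)))
      (fderiv ℝ ψ (x + t • (y - x)) (y - x)) t := by
    intro t
    have h1 : HasDerivAt (fun t : ℝ => x + t • (y - x)) (y - x) t := by
      simpa using ((hasDerivAt_id t).smul_const (y - x)).const_add x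
    exact ((hψ.differentiable (by simp)) _).hasFDerivAt.comp_hasDerivAt t h1
  have hcont : Continuous fun t : ℝ => fderiv ℝ ψ (x + t • (y - x)) (y - x) := by
    have := hψ.continuous_fderiv (by simp)
    fun_prop
  have hint := intervalIntegral.integral_eq_sub_of_hasDerivAt (a := 0) (b := 1)
    (fun t _ => hderiv t) (hcont.intervalIntegrable 0 1)
  rw [one_smul, zero_smul, add_zero, add_sub_cancel,
    intervalIntegral.integral_of_le zero_le_one] at hint
  have hprob : IsProbabilityMeasure (volume.restrict (Ioc (0 : ℝ) 1)) := ⟨by simp⟩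
  rw [← hint, ← lintegral_const_mul _ (by
    have := (continuous_gradSq hψ).measurable
    fun_prop)]
  calc _ ≤ (∫⁻ t in Ioc (0 : ℝ) 1, ‖fderiv ℝ ψ (x + t • (y - x)) (y - x)‖ₑ) ^ 2 :=
        pow_le_pow_left' (enorm_integral_le_lintegral_enorm _) 2
    _ ≤ ∫⁻ t in Ioc (0 : ℝ) 1, ‖fderiv ℝ ψ (x + t • (y - x)) (y - x)‖ₑ ^ 2 :=
        sq_lintegral_enorm_le hcont.aestronglyMeasurable
    _ ≤ _ := lintegral_mono fun t => enorm_fderiv_apply_sq_le ψ _ _ hxy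

theorem setLIntegral_comp_contraction_le {Q : Set (Fin d → ℝ)} (hQ : MeasurableSet Q)
    {D : (Fin d → ℝ) → ℝ≥0∞} (hD : Measurable D) {s : ℝ} (hs : 1 / 2 ≤ s) (c : Fin d → ℝ)
    (hmaps : ∀ x ∈ Q, s • x + c ∈ Q) :
    ∫⁻ x in Q, D (s • x + c) ≤ 2 ^ d * ∫⁻ x in Q, D x := by
  have hs0 : 0 < s := by linarith
  have hDi : Measurable (Q.indicator D) := hD.indicator hQ
  calc ∫⁻ x in Q, D (s • x + c) ≤ ∫⁻ x, Q.indicator D (s • x + c) := by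
        rw [← lintegral_indicator hQ]
        refine lintegral_mono fun x => ?_
        by_cases hx : x ∈ Q
        · simp [hx, hmaps x hx]
        · simp [hx]
    _ = ∫⁻ y, Q.indicator D (y + c) ∂(Measure.map (fun x => s • x) volume) := by
        rw [lintegral_map (by fun_prop) (by fun_prop)]
    _ = ENNReal.ofReal |(s ^ d)⁻¹| * ∫⁻ x in Q, D x := by
        rw [Measure.map_addHaar_smul _ hs0.ne', lintegral_smul_measure,
          lintegral_add_right_eq_self, lintegral_indicator hQ]
        simp
    _ ≤ _ := by
        gcongr
        rw [abs_of_pos (by positivity), ← inv_pow, ENNReal.ofReal_pow (by positivity)]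
        gcongr
        rw [← ENNReal.ofReal_ofNat 2]
        refine ENNReal.ofReal_le_ofReal ?_
        rw [inv_le_comm₀ hs0 (by norm_num)]
        linarith

/-- The point `x + t (y - x)` is an affine image of `y` with ratio `t` and of `x` with ratio `1 -
t`. Substituting in whichever variable has ratio at least `1/2` keeps the Jacobian factor at most
`2^d`; convexity keeps the image in `Q`. -/
theorem lintegral_segment_le {Q : Set (Fin d → ℝ)} (hQ : MeasurableSet Q) (hQc : Convex ℝ Q)
    {D : (Fin d → ℝ) → ℝ≥0∞} (hD : Measurable D) {t : ℝ} (ht : t ∈ Ioc (0 : ℝ) 1) :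
    ∫⁻ x in Q, ∫⁻ y in Q, D (x + t • (y - x)) ≤
      2 ^ d * volume Q * ∫⁻ x in Q, D x := by
  have hmem : ∀ x ∈ Q, ∀ y ∈ Q, x + t • (y - x) ∈ Q := fun x hx y hy =>
    hQc.add_smul_sub_mem hx hy ⟨ht.1.le, ht.2⟩
  have hconst : ∫⁻ _ in Q, (2 ^ d * ∫⁻ x in Q, D x) = 2 ^ d * volume Q * ∫⁻ x in Q, D x := by
    rw [setLIntegral_const]; ring
  rw [← hconst]
  rcases le_total (1 / 2) t with h | h
  · refine setLIntegral_mono' hQ fun x hx => ?_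
    have h1 : ∀ y, x + t • (y - x) = t • y + (x - t • x) := fun y => by
      rw [smul_sub]; abel
    simp only [h1]
    refine setLIntegral_comp_contraction_le hQ hD h _ fun y hy => ?_
    rw [← h1]
    exact hmem x hx y hy
  · rw [lintegral_lintegral_swap (by fun_prop)]
    refine setLIntegral_mono' hQ fun y hy => ?_
    have h1 : ∀ x, x + t • (y - x) = (1 - t) • x + t • y := fun x => by
      rw [smul_sub, sub_smul, one_smul]; abel
    simp only [h1]
    refine setLIntegral_comp_contraction_le hQ hD (by linarith) _ fun x hx => ?_
    rw [← h1]
    exact hmem x hx y hy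

/-- A Poincaré inequality on convex sets. -/
theorem lintegral_enorm_sub_sq_le {Q : Set (Fin d → ℝ)} (hQ : MeasurableSet Q)
    (hQc : Convex ℝ Q) {l : ℝ} (hl : ∀ x ∈ Q, ∀ y ∈ Q, ∀ k, |y k - x k| ≤ l)
    {ψ : (Fin d → ℝ) → ℂ} (hψ : ContDiff ℝ 1 ψ) :
    ∫⁻ x in Q, ∫⁻ y in Q, ‖ψ y - ψ x‖ₑ ^ 2 ≤
      ENNReal.ofReal (d * l ^ 2) * (2 ^ d * volume Q * ∫⁻ x in Q, gradSq ψ x) := by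
  have hg := (continuous_gradSq hψ).measurable
  calc ∫⁻ x in Q, ∫⁻ y in Q, ‖ψ y - ψ x‖ₑ ^ 2
      ≤ ∫⁻ x in Q, ∫⁻ y in Q, ENNReal.ofReal (d * l ^ 2) *
          ∫⁻ t in Ioc (0 : ℝ) 1, gradSq ψ (x + t • (y - x)) :=
        setLIntegral_mono' hQ fun x hx => setLIntegral_mono' hQ fun y hy =>
          enorm_sub_sq_le_lintegral_gradSq hψ x y (hl x hx y hy)
    _ = ENNReal.ofReal (d * l ^ 2) * ∫⁻ x in Q, ∫⁻ y in Q,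
          ∫⁻ t in Ioc (0 : ℝ) 1, gradSq ψ (x + t • (y - x)) := by
        rw [← lintegral_const_mul' _ _ ENNReal.ofReal_ne_top]
        refine lintegral_congr fun x => ?_
        rw [← lintegral_const_mul' _ _ ENNReal.ofReal_ne_top]
    _ = ENNReal.ofReal (d * l ^ 2) * ∫⁻ t in Ioc (0 : ℝ) 1, ∫⁻ x in Q, ∫⁻ y in Q,
          gradSq ψ (x + t • (y - x)) := by
        congr 1
        have h1 : ∀ x, ∫⁻ y in Q, ∫⁻ t in Ioc (0 : ℝ) 1, gradSq ψ (x + t • (y - x)) =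
            ∫⁻ t in Ioc (0 : ℝ) 1, ∫⁻ y in Q, gradSq ψ (x + t • (y - x)) := fun x =>
          lintegral_lintegral_swap (by fun_prop)
        simp only [h1]
        refine lintegral_lintegral_swap (Measurable.aemeasurable ?_)
        exact Measurable.lintegral_prod_right' (ν := volume.restrict Q)
          (f := fun z : ((Fin d → ℝ) × ℝ) × (Fin d → ℝ) =>
            gradSq ψ (z.1.1 + z.1.2 • (z.2 - z.1.1))) (by fun_prop)
    _ ≤ ENNReal.ofReal (d * l ^ 2) * ∫⁻ t in Ioc (0 : ℝ) 1,
          (2 ^ d * volume Q * ∫⁻ x in Q, gradSq ψ x) := by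
        refine mul_le_mul_right ?_ _
        exact setLIntegral_mono' measurableSet_Ioc fun t ht => lintegral_segment_le hQ hQc hg ht
    _ = _ := by simp

/-- A function on a convex set is controlled by its gradient and by any bounded weight. -/
theorem lintegral_weight_mul_lintegral_le {Q : Set (Fin d → ℝ)} (hQ : MeasurableSet Q)
    (hQc : Convex ℝ Q) {l : ℝ} (hl : ∀ x ∈ Q, ∀ y ∈ Q, ∀ k, |y k - x k| ≤ l)
    {ψ : (Fin d → ℝ) → ℂ} (hψ : ContDiff ℝ 1 ψ) {w : (Fin d → ℝ) → ℝ≥0∞} (hw : Measurable w)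
    (hw1 : ∀ x, w x ≤ 1) :
    (∫⁻ x in Q, w x) * ∫⁻ x in Q, ‖ψ x‖ₑ ^ 2 ≤ 2 * volume Q * ((∫⁻ x in Q, w x * ‖ψ x‖ₑ ^ 2) +
      ENNReal.ofReal (d * l ^ 2) * 2 ^ d * ∫⁻ x in Q, gradSq ψ x) := by
  have hψm := hψ.continuous.measurable
  -- Read the product as the double integral of `w x |ψ y|²` and split `ψ y = ψ x + (ψ y - ψ x)`:
  -- the first part is the weighted norm, and the second is the Poincaré term because `w ≤ 1`.
  calc (∫⁻ x in Q, w x) * ∫⁻ x in Q, ‖ψ x‖ₑ ^ 2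
      = ∫⁻ x in Q, ∫⁻ y in Q, w x * ‖ψ y‖ₑ ^ 2 := by
        rw [lintegral_lintegral_mul (by fun_prop) (by fun_prop)]
    _ ≤ ∫⁻ x in Q, ∫⁻ y in Q, (2 * (w x * ‖ψ x‖ₑ ^ 2) + 2 * ‖ψ y - ψ x‖ₑ ^ 2) := by
        refine lintegral_mono fun x => lintegral_mono fun y => ?_
        calc w x * ‖ψ y‖ₑ ^ 2 = w x * ‖ψ x + (ψ y - ψ x)‖ₑ ^ 2 := by rw [add_sub_cancel]
          _ ≤ w x * (2 * (‖ψ x‖ₑ ^ 2 + ‖ψ y - ψ x‖ₑ ^ 2)) := by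
              gcongr
              exact enorm_add_sq_le _ _
          _ = 2 * (w x * ‖ψ x‖ₑ ^ 2) + w x * (2 * ‖ψ y - ψ x‖ₑ ^ 2) := by ring
          _ ≤ _ := by
              exact add_le_add le_rfl (mul_le_of_le_one_left' (hw1 x))
    _ = 2 * volume Q * (∫⁻ x in Q, w x * ‖ψ x‖ₑ ^ 2) +
          2 * ∫⁻ x in Q, ∫⁻ y in Q, ‖ψ y - ψ x‖ₑ ^ 2 := by
        have h1 : ∀ x, ∫⁻ y in Q, (2 * (w x * ‖ψ x‖ₑ ^ 2) + 2 * ‖ψ y - ψ x‖ₑ ^ 2) =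
            2 * volume Q * (w x * ‖ψ x‖ₑ ^ 2) + 2 * ∫⁻ y in Q, ‖ψ y - ψ x‖ₑ ^ 2 := by
          intro x
          rw [lintegral_add_left measurable_const, setLIntegral_const,
            lintegral_const_mul _ (by fun_prop)]
          ring
        simp only [h1]
        have hm : Measurable fun x => ∫⁻ y in Q, ‖ψ y - ψ x‖ₑ ^ 2 :=
          Measurable.lintegral_prod_right' (ν := volume.restrict Q)
            (f := fun z : (Fin d → ℝ) × (Fin d → ℝ) => ‖ψ z.2 - ψ z.1‖ₑ ^ 2) (by fun_prop)
        rw [lintegral_add_left (by fun_prop), lintegral_const_mul _ (by fun_prop),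
          lintegral_const_mul _ hm]
    _ ≤ 2 * volume Q * (∫⁻ x in Q, w x * ‖ψ x‖ₑ ^ 2) +
          2 * (ENNReal.ofReal (d * l ^ 2) * (2 ^ d * volume Q * ∫⁻ x in Q, gradSq ψ x)) := by
        gcongr
        exact lintegral_enorm_sub_sq_le hQ hQc hl hψ
    _ = _ := by ring

end MultiParticle

-- Blocks and the deterministic lower bound on the energy

namespace MultiParticle

open Set

variable {d : ℕ}

/-- The half-open box of side length `m` whose first unit cell is centred at `z`. -/
def block (z : Fin d → ℤ) (m : ℕ) : Set (Fin d → ℝ) :=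
  Set.pi univ fun k => Ico ((z k : ℝ) - 1 / 2) (z k - 1 / 2 + m)

theorem mem_block {z : Fin d → ℤ} {m : ℕ} {x : Fin d → ℝ} :
    x ∈ block z m ↔ ∀ k, (z k : ℝ) - 1 / 2 ≤ x k ∧ x k < z k - 1 / 2 + m := by
  simp [block]

theorem measurableSet_block (z : Fin d → ℤ) (m : ℕ) : MeasurableSet (block z m) :=
  MeasurableSet.univ_pi fun _ => measurableSet_Ico

theorem convex_block (z : Fin d → ℤ) (m : ℕ) : Convex ℝ (block z m) :=
  convex_pi fun _ _ => convex_Ico _ _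

theorem volume_block (z : Fin d → ℤ) (m : ℕ) : volume (block z m) = (m : ℝ≥0∞) ^ d := by
  simp [block, Real.volume_pi_Ico]

theorem abs_sub_le_of_mem_block {z : Fin d → ℤ} {m : ℕ} {x y : Fin d → ℝ} (hx : x ∈ block z m)
    (hy : y ∈ block z m) (k : Fin d) : |y k - x k| ≤ m := by
  have h1 := mem_block.1 hx k
  have h2 := mem_block.1 hy k
  rw [abs_le]
  constructor <;> linarith

theorem mem_block_one {z : Fin d → ℤ} {x : Fin d → ℝ} : x ∈ block z 1 ↔ site x = z := by
  rw [mem_block, funext_iff]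
  refine forall_congr' fun k => ?_
  rw [site, round_eq, Int.floor_eq_iff]
  push_cast
  constructor <;> rintro ⟨h1, h2⟩ <;> constructor <;> linarith

/-- The floor picks out the unique block containing `x`, which yields both disjointness and
covering. The shift `1/2` appears because blocks start half a unit before a lattice point. -/
theorem mem_block_add_smul {u b : Fin d → ℤ} {m : ℕ} (hm : 1 ≤ m) {x : Fin d → ℝ} :
    x ∈ block (u + m • b) m ↔ (fun k => ⌊(x k - u k + 1 / 2) / (m : ℝ)⌋) = b := by
  have hm' : (0 : ℝ) < m := by exact_mod_cast hm
  rw [mem_block, funext_iff]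
  refine forall_congr' fun k => ?_
  rw [Int.floor_eq_iff, le_div_iff₀ hm', div_lt_iff₀ hm']
  have hk : (u + m • b) k = u k + m * b k := by simp
  rw [hk]
  push_cast
  constructor <;> rintro ⟨h1, h2⟩ <;> constructor <;> nlinarith

theorem exists_mem_block {u : Fin d → ℤ} {m : ℕ} (hm : 1 ≤ m) {K : ℕ} {L : ℝ}
    (hK : L + 1 ≤ K * m) {x : Fin d → ℝ} (hx : ∀ k, |x k - u k| < L) :
    ∃ b ∈ Finset.Icc (fun _ : Fin d => -(K : ℤ)) (fun _ => (K : ℤ)), x ∈ block (u + m • b) m := by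
  have hm' : (0 : ℝ) < m := by exact_mod_cast hm
  refine ⟨_, ?_, (mem_block_add_smul hm).2 rfl⟩
  rw [Finset.mem_Icc]
  refine ⟨fun k => ?_, fun k => ?_⟩
  · have := abs_lt.1 (hx k)
    simp only [Int.le_floor]
    rw [le_div_iff₀ hm']
    push_cast
    nlinarith
  · have := abs_lt.1 (hx k)
    have h : (x k - u k + 1 / 2) / (m : ℝ) ≤ K := by
      rw [div_le_iff₀ hm']
      linarith
    exact_mod_cast (Int.floor_le _).trans h

theorem setLIntegral_eq_of_forall_notMem {α : Type*} [MeasurableSpace α] {μ : Measure α}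
    {s : Set α} (hs : MeasurableSet s) {f : α → ℝ≥0∞} (hf : ∀ x ∉ s, f x = 0) :
    ∫⁻ x in s, f x ∂μ = ∫⁻ x, f x ∂μ := by
  rw [← lintegral_indicator hs, Set.indicator_eq_self.2]
  exact fun x hx => by_contra fun h => hx (hf x h)

/-- If every block of side `m` carries a fixed amount of the bounded weight `1 - e^{-v}`, the
one-particle form is bounded below. -/
theorem one_particle_form_bound (hd : 1 ≤ d) {m : ℕ} (hm : 1 ≤ m) {K : ℕ} {L : ℝ}
    (hK : L + 1 ≤ K * m) {u : Fin d → ℤ} {v : (Fin d → ℝ) → ℝ} (hv : Measurable v) {c : ℝ≥0∞}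
    (hc : ∀ b ∈ Finset.Icc (fun _ : Fin d => -(K : ℤ)) (fun _ => (K : ℤ)),
      c ≤ ∫⁻ x in block (u + m • b) m, ENNReal.ofReal (1 - Real.exp (-v x)))
    (hv0 : ∀ x, 0 ≤ v x)
    {ψ : (Fin d → ℝ) → ℂ} (hψ : ContDiff ℝ 1 ψ) (hsupp : ∀ x, ψ x ≠ 0 → ∀ k, |x k - u k| < L) :
    c * ∫⁻ x, ‖ψ x‖ₑ ^ 2 ≤ ENNReal.ofReal (d * 2 ^ (d + 1) * m ^ (d + 2)) *
      ((∫⁻ x, ‖v x‖ₑ * ‖ψ x‖ₑ ^ 2) + ∫⁻ x, gradSq ψ x) := by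
  set I : Finset (Fin d → ℤ) := Finset.Icc (fun _ : Fin d => -(K : ℤ)) (fun _ => (K : ℤ))
  set Q : (Fin d → ℤ) → Set (Fin d → ℝ) := fun b => block (u + m • b) m with hQ
  have hdisj : PairwiseDisjoint (I : Set (Fin d → ℤ)) Q := by
    intro b _ b' _ hbb
    refine Set.disjoint_left.2 fun x hx hx' => hbb ?_
    rw [← (mem_block_add_smul hm).1 hx, ← (mem_block_add_smul hm).1 hx']
  have hmeas : ∀ b ∈ I, MeasurableSet (Q b) := fun b _ => measurableSet_block _ _
  have hU : MeasurableSet (⋃ b ∈ I, Q b) := I.measurableSet_biUnion hmeas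
  have hsum : ∀ f : (Fin d → ℝ) → ℝ≥0∞, ∑ b ∈ I, ∫⁻ x in Q b, f x ≤ ∫⁻ x, f x := fun f => by
    rw [← lintegral_biUnion_finset hdisj hmeas]
    exact setLIntegral_le_lintegral _ _
  have hψsum : ∫⁻ x, ‖ψ x‖ₑ ^ 2 = ∑ b ∈ I, ∫⁻ x in Q b, ‖ψ x‖ₑ ^ 2 := by
    rw [← lintegral_biUnion_finset hdisj hmeas, setLIntegral_eq_of_forall_notMem hU]
    intro x hx
    by_contra hne
    refine hx ?_
    obtain ⟨b, hb, hxb⟩ := exists_mem_block (x := x) hm hK (hsupp x fun h => hne (by simp [h]))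
    exact Set.mem_biUnion hb hxb
  have hw : Measurable fun x => ENNReal.ofReal (1 - Real.exp (-v x)) := by fun_prop
  -- The Poincaré estimate needs a bounded weight, the form contains the unbounded `v`; this
  -- comparison links them.
  have hwle : ∀ x, ENNReal.ofReal (1 - Real.exp (-v x)) ≤ ‖v x‖ₑ := fun x => by
    rw [Real.enorm_of_nonneg (hv0 x)]
    refine ENNReal.ofReal_le_ofReal ?_
    linarith [Real.add_one_le_exp (-v x)]
  -- Twice the block volume `m^d` times the Poincaré factor `d m² 2^d` for diameter `l = m`.
  have hA : ENNReal.ofReal (d * 2 ^ (d + 1) * m ^ (d + 2)) =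
      2 * (m : ℝ≥0∞) ^ d * (ENNReal.ofReal (d * m ^ 2) * 2 ^ d) := by
    have h2 : (2 : ℝ≥0∞) ^ d = ENNReal.ofReal (2 ^ d) := by
      rw [ENNReal.ofReal_pow (by norm_num), ENNReal.ofReal_ofNat]
    have h3 : 2 * (m : ℝ≥0∞) ^ d = ENNReal.ofReal (2 * m ^ d) := by
      rw [ENNReal.ofReal_mul (by norm_num), ENNReal.ofReal_pow (by positivity),
        ENNReal.ofReal_ofNat, ENNReal.ofReal_natCast]
    rw [h2, h3, ← ENNReal.ofReal_mul (by positivity), ← ENNReal.ofReal_mul (by positivity)]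
    congr 1
    ring
  -- Allows the potential term to carry the same constant as the gradient term.
  have hone : (1 : ℝ≥0∞) ≤ ENNReal.ofReal (d * m ^ 2) * 2 ^ d := by
    refine one_le_mul ?_ (one_le_pow₀ (by norm_num))
    rw [← ENNReal.ofReal_one]
    refine ENNReal.ofReal_le_ofReal ?_
    have h1 : (1 : ℝ) ≤ d := by exact_mod_cast hd
    have h2 : (1 : ℝ) ≤ m := by exact_mod_cast hm
    nlinarith
  have hblock : ∀ b ∈ I, c * ∫⁻ x in Q b, ‖ψ x‖ₑ ^ 2 ≤
      ENNReal.ofReal (d * 2 ^ (d + 1) * m ^ (d + 2)) *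
        ((∫⁻ x in Q b, ‖v x‖ₑ * ‖ψ x‖ₑ ^ 2) + ∫⁻ x in Q b, gradSq ψ x) := by
    intro b hb
    have h1 := lintegral_weight_mul_lintegral_le (measurableSet_block (u + m • b) m)
      (convex_block _ _) (fun x hx y hy k => abs_sub_le_of_mem_block hx hy k) hψ hw
      (fun x => by
        rw [← ENNReal.ofReal_one]
        exact ENNReal.ofReal_le_ofReal (by linarith [Real.exp_pos (-v x)]))
    calc c * ∫⁻ x in Q b, ‖ψ x‖ₑ ^ 2 ≤ _ := mul_le_mul_left (hc b hb) _
      _ ≤ _ := h1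
      _ ≤ _ := by
        rw [volume_block, hA, mul_assoc (2 * (m : ℝ≥0∞) ^ d)]
        gcongr
        rw [mul_add]
        gcongr
        refine le_trans ?_ (le_mul_of_one_le_left' hone)
        exact lintegral_mono fun x => mul_le_mul_left (hwle x) _
  rw [hψsum, Finset.mul_sum]
  calc _ ≤ ∑ b ∈ I, ENNReal.ofReal (d * 2 ^ (d + 1) * m ^ (d + 2)) *
        ((∫⁻ x in Q b, ‖v x‖ₑ * ‖ψ x‖ₑ ^ 2) + ∫⁻ x in Q b, gradSq ψ x) :=
        Finset.sum_le_sum hblock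
    _ ≤ _ := by
      rw [← Finset.mul_sum, Finset.sum_add_distrib]
      exact mul_le_mul_right (add_le_add (hsum _) (hsum _)) _

theorem lintegral_conf_succ {n : ℕ} {F : Conf (n + 1) d → ℝ≥0∞} (hF : Measurable F) :
    ∫⁻ z, F z = ∫⁻ y : Conf n d, ∫⁻ x : Fin d → ℝ, F (Fin.cons x y) := by
  have h := volume_preserving_piFinSuccAbove (fun _ : Fin (n + 1) => Fin d → ℝ) 0
  rw [← h.symm.lintegral_comp hF, Measure.volume_eq_prod, lintegral_prod_symm]
  · refine lintegral_congr fun y => lintegral_congr fun x => congrArg F ?_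
    exact Fin.insertNth_zero' x y
  · exact (hF.comp (MeasurableEquiv.measurable _)).aemeasurable

theorem fderiv_cons {n : ℕ} {φ : Conf (n + 1) d → ℂ} (hφ : Differentiable ℝ φ) (y : Conf n d)
    (x : Fin d → ℝ) (k : Fin d) :
    fderiv ℝ (fun x : Fin d → ℝ => φ (Fin.cons x y)) x (Pi.single k 1) =
      pderiv (0, k) φ (Fin.cons x y) := by
  have h1 : (fun x : Fin d → ℝ => (Fin.cons x y : Conf (n + 1) d)) = fun x =>
      ContinuousLinearMap.single ℝ (fun _ : Fin (n + 1) => Fin d → ℝ) 0 x + Fin.cons 0 y := by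
    funext x i
    refine Fin.cases ?_ (fun j => ?_) i <;> simp
  have h2 : HasFDerivAt (fun x : Fin d → ℝ => (Fin.cons x y : Conf (n + 1) d))
      (ContinuousLinearMap.single ℝ (fun _ : Fin (n + 1) => Fin d → ℝ) 0) x := by
    rw [h1]
    exact (ContinuousLinearMap.hasFDerivAt _).add_const _
  have h3 := (hφ (Fin.cons x y)).hasFDerivAt.comp x h2
  have h4 : fderiv ℝ (fun x : Fin d → ℝ => φ (Fin.cons x y)) x = _ := h3.fderiv
  rw [h4]
  rfl

theorem contDiff_cons {n : ℕ} (y : Conf n d) :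
    ContDiff ℝ 1 (fun x : Fin d → ℝ => (Fin.cons x y : Conf (n + 1) d)) := by
  refine contDiff_pi.2 fun i => ?_
  refine Fin.cases ?_ (fun j => ?_) i
  · exact contDiff_id
  · simpa using contDiff_const

theorem interaction_nonneg {n : ℕ} {Φ : ℝ → ℝ} (hΦ : ∀ r : ℝ, 0 ≤ r → 0 ≤ Φ r) (x : Conf n d) :
    0 ≤ interaction Φ x :=
  Finset.sum_nonneg fun _ _ => hΦ _ (norm_nonneg _)

theorem external_nonneg {n : ℕ} {v : (Fin d → ℝ) → ℝ} (hv : ∀ x, 0 ≤ v x) (x : Conf n d) :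
    0 ≤ external v x :=
  Finset.sum_nonneg fun _ _ => hv _

theorem measurable_interaction {n : ℕ} {Φ : ℝ → ℝ} (hΦ : Measurable Φ) :
    Measurable (interaction Φ : Conf n d → ℝ) := by
  unfold interaction
  fun_prop

theorem measurable_external {n : ℕ} {v : (Fin d → ℝ) → ℝ} (hv : Measurable v) :
    Measurable (external v : Conf n d → ℝ) := by
  unfold external
  fun_prop

theorem abs_sub_lt_of_mem_cube {n : ℕ} {u : Fin n → Fin d → ℤ} {L : ℝ} {x : Conf n d}
    (hx : x ∈ cube u L) (i : Fin n) (k : Fin d) : |x i k - u i k| < L := by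
  have h1 : dist x (fun i k => (u i k : ℝ)) < L := hx
  exact lt_of_le_of_lt ((dist_le_pi_dist (x i) (fun k => (u i k : ℝ)) k).trans
    (dist_le_pi_dist x (fun i k => (u i k : ℝ)) i)) h1

/-- With the other particles frozen, each slice of `φ` in the variable of particle `0` obeys the
one-particle bound. Integrating over the slices and restoring the discarded non-negative terms gives
the full form. -/
theorem form_bound {n : ℕ} (hd : 1 ≤ d) (hn : 0 < n) {m : ℕ} (hm : 1 ≤ m) {K : ℕ} {L : ℝ}
    (hK : L + 1 ≤ K * m) {u : Fin n → Fin d → ℤ} {Φ : ℝ → ℝ} (hΦ : ∀ r : ℝ, 0 ≤ r → 0 ≤ Φ r)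
    {v : (Fin d → ℝ) → ℝ} (hv : Measurable v) {c : ℝ≥0∞}
    (hc : ∀ b ∈ Finset.Icc (fun _ : Fin d => -(K : ℤ)) (fun _ => (K : ℤ)),
      c ≤ ∫⁻ x in block (u ⟨0, hn⟩ + m • b) m, ENNReal.ofReal (1 - Real.exp (-v x)))
    (hv0 : ∀ x, 0 ≤ v x) {φ : Conf n d → ℂ} (hφ : IsTest (cube u L) φ) :
    c * ∫⁻ x in cube u L, ‖φ x‖ₑ ^ 2 ≤ ENNReal.ofReal (d * 2 ^ (d + 1) * m ^ (d + 2)) *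
      ((∑ a, ∫⁻ x in cube u L, ‖pderiv a φ x‖ₑ ^ 2) +
        ∫⁻ x in cube u L, ‖interaction Φ x + external v x‖ₑ * ‖φ x‖ₑ ^ 2) := by
  obtain ⟨n, rfl⟩ := Nat.exists_eq_succ_of_ne_zero hn.ne'
  have hC : MeasurableSet (cube u L) := measurableSet_ball
  have hφ0 : ∀ x ∉ cube u L, φ x = 0 := fun x hx =>
    image_eq_zero_of_notMem_tsupport fun h => hx (hφ.support h)
  have hpd0 : ∀ a, ∀ x ∉ cube u L, pderiv a φ x = 0 := fun a x hx => by
    rw [pderiv, fderiv_of_notMem_tsupport ℝ fun h => hx (hφ.support h)]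
    simp
  have hφm : Measurable φ := hφ.smooth.continuous.measurable
  have hpdm : ∀ a, Measurable (pderiv a φ) := fun a => (hφ.continuous_pderiv a).measurable
  have hcons : ∀ y : Conf n d, Measurable fun x : Fin d → ℝ => (Fin.cons x y : Conf (n + 1) d) :=
    fun y => (contDiff_cons y).continuous.measurable
  have hgm : Measurable fun z : Conf (n + 1) d => ∑ k, ‖pderiv (0, k) φ z‖ₑ ^ 2 := by fun_prop
  have hvm : Measurable fun z : Conf (n + 1) d => ‖v (z 0)‖ₑ * ‖φ z‖ₑ ^ 2 := by fun_prop
  have key : c * ∫⁻ z, ‖φ z‖ₑ ^ 2 ≤ ENNReal.ofReal (d * 2 ^ (d + 1) * m ^ (d + 2)) *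
      ∫⁻ z : Conf (n + 1) d,
        (‖v (z 0)‖ₑ * ‖φ z‖ₑ ^ 2 + ∑ k, ‖pderiv (0, k) φ z‖ₑ ^ 2) := by
    rw [lintegral_conf_succ (by fun_prop), lintegral_conf_succ (by fun_prop),
      ← lintegral_const_mul' _ _ ENNReal.ofReal_ne_top]
    refine (lintegral_const_mul_le _ _).trans (lintegral_mono fun y => ?_)
    refine (one_particle_form_bound hd hm hK hv hc hv0
      (ψ := fun x => φ (Fin.cons x y)) ((hφ.smooth.of_le (by simp)).comp (contDiff_cons y))
      fun x hx k => ?_).trans (le_of_eq ?_)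
    · have := abs_sub_lt_of_mem_cube (by_contra fun h => hx (hφ0 _ h)) 0 k
      simpa using this
    · congr 1
      rw [← lintegral_add_left]
      · refine lintegral_congr fun x => ?_
        rw [Fin.cons_zero, gradSq]
        simp only [fderiv_cons hφ.differentiable y]
      · have := hcons y
        fun_prop
  rw [setLIntegral_eq_of_forall_notMem hC fun x hx => by simp [hφ0 x hx]]
  refine key.trans (mul_le_mul_right ?_ _)
  rw [lintegral_add_left hvm, add_comm]
  refine add_le_add ?_ ?_
  · rw [lintegral_finsetSum _ (by fun_prop), Fintype.sum_prod_type]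
    refine (le_of_eq ?_).trans (Finset.single_le_sum (f := fun i =>
      ∑ k, ∫⁻ x in cube u L, ‖pderiv (i, k) φ x‖ₑ ^ 2) (fun _ _ => bot_le)
      (Finset.mem_univ (0 : Fin (n + 1))))
    refine Finset.sum_congr rfl fun k _ => ?_
    rw [setLIntegral_eq_of_forall_notMem hC fun x hx => by simp [hpd0 _ x hx]]
  · rw [setLIntegral_eq_of_forall_notMem hC fun x hx => by simp [hφ0 x hx]]
    refine lintegral_mono fun z => mul_le_mul_left ?_ _
    have h1 := interaction_nonneg hΦ z
    have h2 : v (z 0) ≤ external v z :=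
      Finset.single_le_sum (f := fun i => v (z i)) (fun i _ => hv0 _) (Finset.mem_univ 0)
    rw [Real.enorm_of_nonneg (hv0 _), Real.enorm_of_nonneg (by linarith [hv0 (z 0)])]
    exact ENNReal.ofReal_le_ofReal (by linarith)

theorem lintegral_cube_external_lt_top {n : ℕ} {v : (Fin d → ℝ) → ℝ}
    (hloc : LocallyIntegrable v) (u : Fin n → Fin d → ℤ) {L : ℝ} (hL : 0 < L) :
    ∫⁻ x in cube u L, ‖external v x‖ₑ < ∞ := by
  have hball : ∀ i, IntegrableOn v (Metric.ball (fun k => (u i k : ℝ)) L) := fun i =>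
    (hloc.integrableOn_isCompact (isCompact_closedBall (fun k => (u i k : ℝ)) L)).mono_set
      Metric.ball_subset_closedBall
  have hmu : (volume : Measure (Conf n d)).restrict (cube u L) =
      Measure.pi fun i => volume.restrict (Metric.ball (fun k => (u i k : ℝ)) L) := by
    rw [cube, ball_pi _ hL, volume_pi, Measure.restrict_pi_pi]
  have hfin : ∀ i, IsFiniteMeasure
      ((volume : Measure (Fin d → ℝ)).restrict (Metric.ball (fun k => (u i k : ℝ)) L)) := fun i =>
    ⟨by simpa using (Metric.isBounded_ball).measure_lt_top⟩
  rw [hmu]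
  have : Integrable (external v : Conf n d → ℝ)
      (Measure.pi fun i => volume.restrict (Metric.ball (fun k => (u i k : ℝ)) L)) :=
    integrable_finsetSum _ fun i _ => integrable_comp_eval (hball i)
  exact this.2

theorem interaction_le {n : ℕ} {Φ : ℝ → ℝ} {M : ℝ} (hM : ∀ r : ℝ, 0 ≤ r → Φ r ≤ M)
    (x : Conf n d) :
    interaction Φ x ≤ ∑ _q : Fin n × Fin n with _q.1 < _q.2, M :=
  Finset.sum_le_sum fun _ _ => hM _ (norm_nonneg _)

/-- Finite potential energy of test functions makes `testGraph` contain all of `C_c^∞`. It holds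
because `φ` and the interaction are bounded and each `V(x_i)` is integrable over the product cube.
-/
theorem lintegral_cube_potential_lt_top {n : ℕ} {Φ : ℝ → ℝ}
    (hΦ : ∀ r : ℝ, 0 ≤ r → 0 ≤ Φ r) {M : ℝ} (hM : ∀ r : ℝ, 0 ≤ r → Φ r ≤ M)
    {v : (Fin d → ℝ) → ℝ} (hloc : LocallyIntegrable v)
    (u : Fin n → Fin d → ℤ) {L : ℝ} (hL : 0 < L) {φ : Conf n d → ℂ} (hφ : IsTest (cube u L) φ) :
    ∫⁻ x in cube u L, ‖interaction Φ x + external v x‖ₑ * ‖φ x‖ₑ ^ 2 < ∞ := by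
  obtain ⟨B, hB⟩ := hφ.smooth.continuous.bounded_above_of_compact_support hφ.compact
  have hB' : ∀ x, ‖φ x‖ₑ ^ 2 ≤ ENNReal.ofReal B ^ 2 := fun x => by
    rw [← ofReal_norm]
    gcongr
    exact hB x
  set S : ℝ := ∑ _q : Fin n × Fin n with _q.1 < _q.2, M
  have hvol : volume (cube u L) < ∞ := Metric.isBounded_ball.measure_lt_top
  calc ∫⁻ x in cube u L, ‖interaction Φ x + external v x‖ₑ * ‖φ x‖ₑ ^ 2
      ≤ ∫⁻ x in cube u L, (ENNReal.ofReal S + ‖external v x‖ₑ) * ENNReal.ofReal B ^ 2 := by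
        refine lintegral_mono fun x => mul_le_mul' ((enorm_add_le _ _).trans ?_) (hB' x)
        gcongr
        rw [Real.enorm_of_nonneg (interaction_nonneg hΦ x)]
        exact ENNReal.ofReal_le_ofReal (interaction_le hM x)
    _ = (ENNReal.ofReal S * volume (cube u L) + ∫⁻ x in cube u L, ‖external v x‖ₑ) *
          ENNReal.ofReal B ^ 2 := by
        rw [lintegral_mul_const' _ _ (by finiteness), lintegral_add_left measurable_const,
          setLIntegral_const]
    _ < ∞ := by
        have := lintegral_cube_external_lt_top hloc u hL
        finiteness

/-- A deterministic lower bound of the ground state energy. -/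
theorem le_groundEnergy {n : ℕ} (hd : 1 ≤ d) (hn : 0 < n) {m : ℕ} (hm : 1 ≤ m) {K : ℕ} {L : ℝ}
    (hL : 0 < L) (hK : L + 1 ≤ K * m) {u : Fin n → Fin d → ℤ} {Φ : ℝ → ℝ} (hΦm : Measurable Φ)
    (hΦ : ∀ r : ℝ, 0 ≤ r → 0 ≤ Φ r) {M : ℝ} (hM : ∀ r : ℝ, 0 ≤ r → Φ r ≤ M)
    {v : (Fin d → ℝ) → ℝ} (hv : Measurable v) (hv0 : ∀ x, 0 ≤ v x) (hloc : LocallyIntegrable v)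
    {c γ : ℝ} (hγ : 0 < γ) (hcγ : γ * (d * 2 ^ (d + 1) * m ^ (d + 2)) ≤ c)
    (hc : ∀ b ∈ Finset.Icc (fun _ : Fin d => -(K : ℤ)) (fun _ => (K : ℤ)),
      ENNReal.ofReal c ≤
        ∫⁻ x in block (u ⟨0, hn⟩ + m • b) m, ENNReal.ofReal (1 - Real.exp (-v x))) :
    (γ : EReal) ≤ groundEnergy Φ v u L := by
  refine le_spectralBottom_dirichletGraph
    ((measurable_interaction hΦm).add (measurable_external hv))
    (fun x => add_nonneg (interaction_nonneg hΦ x) (external_nonneg hv0 x))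
    (fun φ hφ => lintegral_cube_potential_lt_top hΦ hM hloc u hL hφ) hγ fun φ hφ => ?_
  have h1 := form_bound hd hn hm hK hΦ hv hc hv0 hφ
  have hA : (0 : ℝ) < d * 2 ^ (d + 1) * m ^ (d + 2) := by
    have h1 : (0 : ℝ) < d := by exact_mod_cast hd
    have h2 : (0 : ℝ) < m := by exact_mod_cast hm
    positivity
  have hA0 : ENNReal.ofReal (d * 2 ^ (d + 1) * m ^ (d + 2)) ≠ 0 := by simpa using hA
  rw [← ENNReal.mul_le_mul_iff_right hA0 ENNReal.ofReal_ne_top]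
  refine le_trans ?_ h1
  rw [← mul_assoc, ← ENNReal.ofReal_mul hA.le]
  refine mul_le_mul_left (ENNReal.ofReal_le_ofReal ?_) _
  linarith

end MultiParticle

-- Cell weights, their measurability, and mixing

namespace MultiParticle

open Set Filter Topology

theorem integral_mul_sub_condExp_eq_zero {Ω : Type*} {m mΩ : MeasurableSpace Ω} (hm : m ≤ mΩ)
    {P : Measure Ω} [IsFiniteMeasure P] {f Y : Ω → ℝ} (hf : StronglyMeasurable[m] f)
    (hY : Integrable Y P) (hfZ : Integrable (f * (Y - P[Y | m])) P) :
    ∫ ω, f ω * (Y ω - (P[Y | m]) ω) ∂P = 0 := by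
  have h1 := condExp_mul_of_stronglyMeasurable_left hf hfZ (hY.sub integrable_condExp)
  have h2 := condExp_sub hY (integrable_condExp (μ := P) (m := m) (f := Y)) m
  have h3 : P[P[Y | m] | m] = P[Y | m] :=
    condExp_of_stronglyMeasurable hm stronglyMeasurable_condExp integrable_condExp
  have h4 : P[f * (Y - P[Y | m]) | m] =ᵐ[P] 0 := by
    filter_upwards [h1, h2] with ω h1 h2
    rw [h1, Pi.mul_apply, h2, h3]
    simp
  have h5 := integral_condExp (μ := P) (f := f * (Y - P[Y | m])) hm
  rw [integral_congr_ae h4] at h5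
  simpa using h5.symm

/-- The average of a bounded jointly measurable field is almost surely measurable with respect to
any sigma-algebra for which the field is measurable. -/
theorem integral_ae_eq_condExp {E Ω : Type*} [MeasurableSpace E] {m mΩ : MeasurableSpace Ω}
    (hm : m ≤ mΩ) {P : Measure Ω} [IsProbabilityMeasure P] {μ : Measure E} [IsFiniteMeasure μ]
    {w : E → Ω → ℝ} (hw : Measurable (Function.uncurry w)) (hw0 : ∀ x ω, 0 ≤ w x ω)
    (hw1 : ∀ x ω, w x ω ≤ 1) (hwm : ∀ᵐ x ∂μ, Measurable[m] (w x)) :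
    (fun ω => ∫ x, w x ω ∂μ) =ᵐ[P] P[fun ω => ∫ x, w x ω ∂μ | m] := by
  set Y : Ω → ℝ := fun ω => ∫ x, w x ω ∂μ with hYdef
  have hYm : StronglyMeasurable Y :=
    StronglyMeasurable.integral_prod_left' (f := Function.uncurry w) hw.stronglyMeasurable
  have hYb : ∀ ω, |Y ω| ≤ μ.real univ := by
    intro ω
    have := norm_integral_le_of_norm_le_const (μ := μ) (f := fun x => w x ω) (C := 1)
      (Eventually.of_forall fun x => by
        rw [Real.norm_of_nonneg (hw0 x ω)]; exact hw1 x ω)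
    simpa using this
  have hYi : Integrable Y P :=
    Integrable.of_bound hYm.aestronglyMeasurable _ (Eventually.of_forall hYb)
  have hcb : ∀ᵐ ω ∂P, |(P[Y | m]) ω| ≤ μ.real univ :=
    ae_bdd_abs_condExp_of_ae_bdd_abs (Eventually.of_forall hYb)
  set R : ℝ := μ.real univ
  set Z : Ω → ℝ := Y - P[Y | m] with hZdef
  have hZi : Integrable Z P := hYi.sub integrable_condExp
  have hZb : ∀ᵐ ω ∂P, ‖Z ω‖ ≤ R + R := by
    filter_upwards [hcb] with ω h
    exact (norm_sub_le _ _).trans (add_le_add (hYb ω) h)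
  -- Each `w x` is `m`-measurable, hence orthogonal to `Z = Y - E[Y | m]`; by Fubini so is their
  -- average `Y`. Since `E[Y | m]` is orthogonal to `Z` too, `E[Z²] = 0`.
  have hfst : ∫ ω, Y ω * Z ω ∂P = 0 := by
    have h1 : ∀ ω, Y ω * Z ω = ∫ x, w x ω * Z ω ∂μ := fun ω => (integral_mul_const _ _).symm
    simp only [h1]
    have hint : Integrable (Function.uncurry fun ω x => w x ω * Z ω) (P.prod μ) := by
      refine Integrable.bdd_mul (c := 1) (f := fun z : Ω × E => w z.2 z.1)
        (g := fun z : Ω × E => Z z.1) (hZi.comp_fst μ)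
        (hw.comp measurable_swap).aestronglyMeasurable
        (Eventually.of_forall fun z => ?_)
      rw [Real.norm_of_nonneg (hw0 _ _)]
      exact hw1 _ _
    rw [integral_integral_swap hint]
    rw [← integral_zero E ℝ (μ := μ)]
    refine integral_congr_ae ?_
    filter_upwards [hwm] with x hx
    refine integral_mul_sub_condExp_eq_zero hm hx.stronglyMeasurable hYi ?_
    refine hZi.bdd_mul (c := 1) (hx.mono hm le_rfl).aestronglyMeasurable
      (Eventually.of_forall fun ω => ?_)
    rw [Real.norm_of_nonneg (hw0 _ _)]
    exact hw1 _ _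
  have hcZ : Integrable (P[Y | m] * Z) P :=
    hZi.bdd_mul (c := R) integrable_condExp.aestronglyMeasurable hcb
  have hsnd : ∫ ω, (P[Y | m]) ω * Z ω ∂P = 0 :=
    integral_mul_sub_condExp_eq_zero hm stronglyMeasurable_condExp hYi hcZ
  have hYZ : Integrable (fun ω => Y ω * Z ω) P :=
    hZi.bdd_mul (c := R) hYm.aestronglyMeasurable (Eventually.of_forall hYb)
  have hsq : ∫ ω, Z ω ^ 2 ∂P = 0 := by
    have h1 : ∀ ω, Z ω ^ 2 = Y ω * Z ω - (P[Y | m]) ω * Z ω := fun ω => by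
      rw [← sub_mul, sq]; rfl
    simp only [h1]
    have hcZ' : Integrable (fun ω => (P[Y | m]) ω * Z ω) P := hcZ
    rw [integral_sub hYZ hcZ', hfst, hsnd, sub_zero]
  have hZ2 : Integrable (fun ω => Z ω ^ 2) P := by
    have := hZi.bdd_mul (c := R + R) hZi.aestronglyMeasurable hZb
    simpa only [sq] using this
  rw [integral_eq_zero_iff_of_nonneg (fun ω => sq_nonneg _) hZ2] at hsq
  filter_upwards [hsq] with ω h
  exact sub_eq_zero.1 (pow_eq_zero_iff two_ne_zero |>.1 h)

section RandomField

variable {d : ℕ} {Ω : Type*} {V : (Fin d → ℝ) → Ω → ℝ}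

theorem fieldSigma_mono {S T : Set (Fin d → ℤ)} (h : S ⊆ T) : fieldSigma V S ≤ fieldSigma V T :=
  iSup_le fun x => le_iSup (fun y : {y : Fin d → ℝ // site y ∈ T} =>
    MeasurableSpace.comap (V y) inferInstance) ⟨x.1, h x.2⟩

theorem measurable_fieldSigma {S : Set (Fin d → ℤ)} {x : Fin d → ℝ} (hx : site x ∈ S) :
    Measurable[fieldSigma V S] (V x) :=
  (comap_measurable (V x)).mono (le_iSup (fun y : {y : Fin d → ℝ // site y ∈ S} =>
    MeasurableSpace.comap (V y) inferInstance) ⟨x, hx⟩) le_rfl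

theorem one_sub_exp_mem_Icc (hV0 : ∀ x ω, 0 ≤ V x ω) (x : Fin d → ℝ) (ω : Ω) :
    1 - Real.exp (-V x ω) ∈ Icc (0 : ℝ) 1 :=
  ⟨by linarith [Real.exp_le_one_iff.2 (neg_nonpos.2 (hV0 x ω))],
    by linarith [Real.exp_pos (-V x ω)]⟩

variable [MeasurableSpace Ω] {P : Measure Ω}

/-- The weight `∫ (1 - e^{-V})` of the unit cell around `z`. -/
noncomputable def cellWeight (V : (Fin d → ℝ) → Ω → ℝ) (z : Fin d → ℤ) (ω : Ω) : ℝ :=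
  ∫ x in block z 1, (1 - Real.exp (-V x ω))

theorem measurable_field (hV : Measurable (Function.uncurry V)) (x : Fin d → ℝ) :
    Measurable (V x) :=
  hV.comp measurable_prodMk_left

theorem measurable_sample (hV : Measurable (Function.uncurry V)) (ω : Ω) :
    Measurable fun x => V x ω :=
  hV.comp measurable_prodMk_right

theorem fieldSigma_le (hV : Measurable (Function.uncurry V)) (S : Set (Fin d → ℤ)) :
    fieldSigma V S ≤ ‹MeasurableSpace Ω› :=
  iSup_le fun x => (measurable_field hV x).comap_le

theorem volume_block_one (z : Fin d → ℤ) : volume (block z 1) = 1 := by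
  simp [volume_block]

theorem isProbabilityMeasure_restrict_block (z : Fin d → ℤ) :
    IsProbabilityMeasure ((volume : Measure (Fin d → ℝ)).restrict (block z 1)) :=
  ⟨by simp [volume_block_one]⟩

theorem measurable_one_sub_exp (hV : Measurable (Function.uncurry V)) :
    Measurable (Function.uncurry fun x ω => 1 - Real.exp (-V x ω)) :=
  measurable_const.sub (Real.measurable_exp.comp hV.neg)

theorem measurable_cellWeight (hV : Measurable (Function.uncurry V)) (z : Fin d → ℤ) :
    Measurable (cellWeight V z) :=
  (StronglyMeasurable.integral_prod_left' (f := Function.uncurry fun x ω => 1 - Real.exp (-V x ω))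
    (measurable_one_sub_exp hV).stronglyMeasurable).measurable

/-- `cellWeight` integrates uncountably many field variables, and joint measurability is known only
for the full sigma-algebra. Mixing is therefore applied to a version of the event built from the
conditional expectation. -/
theorem exists_measurableSet_ae_eq_cellWeight_lt [IsProbabilityMeasure P]
    (hV : Measurable (Function.uncurry V)) (hV0 : ∀ x ω, 0 ≤ V x ω) (z : Fin d → ℤ) (c : ℝ) :
    ∃ A : Set Ω, MeasurableSet[fieldSigma V {z}] A ∧ A =ᵐ[P] {ω | cellWeight V z ω < c} := by
  have hp := isProbabilityMeasure_restrict_block z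
  have h := integral_ae_eq_condExp (m := fieldSigma V {z}) (fieldSigma_le hV _) (P := P)
    (μ := volume.restrict (block z 1)) (w := fun x ω => 1 - Real.exp (-V x ω))
    (measurable_one_sub_exp hV)
    (fun x ω => (one_sub_exp_mem_Icc hV0 x ω).1) (fun x ω => (one_sub_exp_mem_Icc hV0 x ω).2) (by
      filter_upwards [ae_restrict_mem (measurableSet_block z 1)] with x hx
      have hx' : Measurable[fieldSigma V {z}] (V x) :=
        measurable_fieldSigma (S := {z}) (mem_block_one.1 hx)
      exact measurable_const.sub (Real.measurable_exp.comp hx'.neg))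
  refine ⟨(P[cellWeight V z | fieldSigma V {z}]) ⁻¹' Iio c,
    stronglyMeasurable_condExp.measurable measurableSet_Iio, ?_⟩
  filter_upwards [h] with ω hω
  refine propext ?_
  change (P[cellWeight V z | fieldSigma V {z}]) ω < c ↔ cellWeight V z ω < c
  rw [show cellWeight V z ω = (P[cellWeight V z | fieldSigma V {z}]) ω from hω]

/-- The weight lies in `[0, 1]` and has mean at least `η`, while it is at most `η / 2` plus the
indicator of being at least `η / 2`. Taking expectations gives the bound. -/
theorem measureReal_cellWeight_lt_le [IsProbabilityMeasure P]
    (hV : Measurable (Function.uncurry V)) (hV0 : ∀ x ω, 0 ≤ V x ω) {η : ℝ} (hη : 0 < η)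
    (hE : ∀ x, ∫ ω, Real.exp (-V x ω) ∂P ≤ 1 - η) (z : Fin d → ℤ) :
    P.real {ω | cellWeight V z ω < η / 2} ≤ 1 - η / 2 := by
  have hp := isProbabilityMeasure_restrict_block z
  have hwm := measurable_one_sub_exp hV
  have hYm := measurable_cellWeight hV z
  have hY1 : ∀ ω, cellWeight V z ω ≤ 1 := by
    intro ω
    have := norm_integral_le_of_norm_le_const (μ := volume.restrict (block z 1))
      (f := fun x => 1 - Real.exp (-V x ω)) (C := 1) (Eventually.of_forall fun x => by
        rw [Real.norm_of_nonneg (one_sub_exp_mem_Icc hV0 x ω).1]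
        exact (one_sub_exp_mem_Icc hV0 x ω).2)
    rw [probReal_univ, mul_one] at this
    exact (le_abs_self _).trans this
  have hY0 : ∀ ω, 0 ≤ cellWeight V z ω := fun ω =>
    integral_nonneg fun x => (one_sub_exp_mem_Icc hV0 x ω).1
  have hexp : ∀ x, Integrable (fun ω => Real.exp (-V x ω)) P := fun x =>
    Integrable.of_bound (Real.measurable_exp.comp (measurable_field hV x).neg).aestronglyMeasurable
      1 (Eventually.of_forall fun ω => by
        rw [Real.norm_of_nonneg (Real.exp_pos _).le]
        linarith [(one_sub_exp_mem_Icc hV0 x ω).1])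
  have hmean : η ≤ ∫ ω, cellWeight V z ω ∂P := by
    unfold cellWeight
    rw [integral_integral_swap (f := fun ω x => 1 - Real.exp (-V x ω))]
    · have hi : Integrable (fun x => ∫ ω, (1 - Real.exp (-V x ω)) ∂P)
          (volume.restrict (block z 1)) := by
        refine Integrable.of_bound (StronglyMeasurable.integral_prod_right'
          (f := Function.uncurry fun x ω => 1 - Real.exp (-V x ω))
          hwm.stronglyMeasurable).aestronglyMeasurable 1 (Eventually.of_forall fun x => ?_)
        have := norm_integral_le_of_norm_le_const (μ := P)
          (f := fun ω => 1 - Real.exp (-V x ω)) (C := 1) (Eventually.of_forall fun ω => by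
            rw [Real.norm_of_nonneg (one_sub_exp_mem_Icc hV0 x ω).1]
            exact (one_sub_exp_mem_Icc hV0 x ω).2)
        simpa using this
      calc η = ∫ _ in block z 1, η := by simp
        _ ≤ _ := by
          refine integral_mono (integrable_const _) hi fun x => ?_
          change η ≤ ∫ ω, (1 - Real.exp (-V x ω)) ∂P
          rw [integral_sub (integrable_const _) (hexp x)]
          simp only [integral_const, probReal_univ, smul_eq_mul, mul_one]
          linarith [hE x]
    · refine Integrable.of_bound (hwm.comp measurable_swap).aestronglyMeasurable 1
        (Eventually.of_forall fun p => ?_)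
      change ‖1 - Real.exp (-V p.2 p.1)‖ ≤ 1
      rw [Real.norm_of_nonneg (one_sub_exp_mem_Icc hV0 _ _).1]
      exact (one_sub_exp_mem_Icc hV0 _ _).2
  have hmeas : MeasurableSet {ω | cellWeight V z ω < η / 2} := hYm measurableSet_Iio
  have hind : Integrable ({ω | cellWeight V z ω < η / 2}ᶜ.indicator (1 : Ω → ℝ)) P :=
    (integrable_const (1 : ℝ)).indicator hmeas.compl
  have hle : ∫ ω, cellWeight V z ω ∂P ≤
      ∫ ω, ({ω | cellWeight V z ω < η / 2}ᶜ.indicator 1 ω + η / 2) ∂P := by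
    refine integral_mono (Integrable.of_bound hYm.aestronglyMeasurable 1
      (Eventually.of_forall fun ω => ?_)) ?_ fun ω => ?_
    · rw [Real.norm_of_nonneg (hY0 ω)]; exact hY1 ω
    · exact hind.add (integrable_const _)
    · by_cases h : cellWeight V z ω < η / 2
      · simp [h, h.le]
      · simp only [mem_compl_iff, mem_ofPred_eq, h, not_false_eq_true, indicator_of_mem,
          Pi.one_apply]
        linarith [hY1 ω]
  rw [integral_add hind (integrable_const _),
    integral_indicator_one hmeas.compl, probReal_compl_eq_one_sub hmeas] at hle
  simp only [integral_const, probReal_univ, smul_eq_mul, one_mul] at hle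
  linarith

/-- Mixing makes the joint occurrence of separated events exponentially unlikely. -/
theorem measureReal_iInter_le [IsProbabilityMeasure P] {ε ρ r : ℝ} (hρ0 : 0 ≤ ρ) (hρ1 : ρ ≤ 1)
    (hε : 0 ≤ ε)
    (hmix : ∀ S T : Set (Fin d → ℤ), (∀ j ∈ S, ∀ k ∈ T, r ≤ dist j k) →
      ∀ A B : Set Ω, MeasurableSet[fieldSigma V S] A → MeasurableSet[fieldSigma V T] B →
      |P.real (A ∩ B) - P.real A * P.real B| ≤ ε)
    {z : ℕ → Fin d → ℤ} (hz : ∀ i j, i < j → r ≤ dist (z i) (z j)) {A : ℕ → Set Ω}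
    (hA : ∀ i, MeasurableSet[fieldSigma V {z i}] (A i)) (hPA : ∀ i, P.real (A i) ≤ ρ) (k : ℕ) :
    P.real (⋂ i ∈ Finset.range k, A i) ≤ ρ ^ k + k * ε := by
  induction k with
  | zero => simp
  | succ k ih =>
    have hB : MeasurableSet[fieldSigma V (z '' Iio k)] (⋂ i ∈ Finset.range k, A i) := by
      refine Finset.measurableSet_biInter _ fun i hi => ?_
      refine fieldSigma_mono (S := {z i}) ?_ _ (hA i)
      rintro _ rfl
      exact ⟨i, Finset.mem_range.1 hi, rfl⟩
    -- The first `k` events jointly live on the first `k` sites, all at distance at least `r` from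
    -- `z k`; adding one event costs a factor `ρ` and one mixing error `ε`.
    have h1 := hmix (z '' Iio k) {z k} (by
      rintro _ ⟨i, hi, rfl⟩ _ rfl
      exact hz i k hi) _ _ hB (hA k)
    have h2 : ⋂ i ∈ Finset.range (k + 1), A i = (⋂ i ∈ Finset.range k, A i) ∩ A k := by
      rw [Finset.range_add_one, Finset.set_biInter_insert, inter_comm]
    rw [h2]
    have h3 := (abs_le.1 h1).2
    have h4 : P.real (⋂ i ∈ Finset.range k, A i) * P.real (A k) ≤ (ρ ^ k + k * ε) * ρ :=
      mul_le_mul ih (hPA k) measureReal_nonneg (by positivity)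
    have h5 : (k : ℝ) * ε * ρ ≤ k * ε := mul_le_of_le_one_right (by positivity) hρ1
    push_cast
    rw [pow_succ]
    linarith

/-- The centres of `r`-separated unit cells in a row. -/
def rowSite (hd : 1 ≤ d) (z : Fin d → ℤ) (r j : ℕ) : Fin d → ℤ :=
  z + Pi.single ⟨0, hd⟩ ((j * r : ℕ) : ℤ)

theorem le_dist_rowSite (hd : 1 ≤ d) (z : Fin d → ℤ) (r : ℕ) {i j : ℕ} (hij : i < j) :
    (r : ℝ) ≤ dist (rowSite hd z r i) (rowSite hd z r j) := by
  refine le_trans ?_ (dist_le_pi_dist _ _ ⟨0, hd⟩)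
  rw [dist_comm, Int.dist_eq]
  simp only [rowSite, Pi.add_apply, Pi.single_eq_same]
  push_cast
  refine le_trans ?_ (le_abs_self _)
  have : (i : ℝ) + 1 ≤ j := by exact_mod_cast hij
  nlinarith [(Nat.cast_nonneg r : (0 : ℝ) ≤ r)]

/-- The last cell ends at offset `(k - 1) r + 1 ≤ k r`, which is where `1 ≤ r` enters. -/
theorem block_rowSite_subset (hd : 1 ≤ d) (z : Fin d → ℤ) {r k m j : ℕ} (hr : 1 ≤ r) (hj : j < k)
    (hm : k * r ≤ m) : block (rowSite hd z r j) 1 ⊆ block z m := by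
  intro x hx
  rw [mem_block] at hx ⊢
  intro i
  obtain ⟨h1, h2⟩ := hx i
  have hjr : j * r + 1 ≤ m := by nlinarith
  have hjr' : (j : ℝ) * r + 1 ≤ m := by exact_mod_cast hjr
  have hjr0 : (0 : ℝ) ≤ j * r := by positivity
  have hz : ((rowSite hd z r j i : ℤ) : ℝ) = z i ∨
      ((rowSite hd z r j i : ℤ) : ℝ) = z i + j * r := by
    by_cases h : i = ⟨0, hd⟩
    · right; subst h; simp [rowSite]
    · left; simp [rowSite, h]
  push_cast at h2
  rcases hz with h | h <;> rw [h] at h1 h2 <;> constructor <;> linarith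

theorem measureReal_forall_cellWeight_lt_le [IsProbabilityMeasure P] (hd : 1 ≤ d)
    (hV : Measurable (Function.uncurry V)) (hV0 : ∀ x ω, 0 ≤ V x ω) {η : ℝ} (hη : 0 < η)
    (hη1 : η ≤ 1) (hE : ∀ x, ∫ ω, Real.exp (-V x ω) ∂P ≤ 1 - η) {ε : ℝ} {r : ℕ} (hε : 0 ≤ ε)
    (hmix : ∀ S T : Set (Fin d → ℤ), (∀ j ∈ S, ∀ k ∈ T, (r : ℝ) ≤ dist j k) →
      ∀ A B : Set Ω, MeasurableSet[fieldSigma V S] A → MeasurableSet[fieldSigma V T] B →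
      |P.real (A ∩ B) - P.real A * P.real B| ≤ ε) (z : Fin d → ℤ) (k : ℕ) :
    P.real {ω | ∀ j < k, cellWeight V (rowSite hd z r j) ω < η / 2} ≤
      (1 - η / 2) ^ k + k * ε := by
  choose A hA hAe using fun j => exists_measurableSet_ae_eq_cellWeight_lt (P := P) hV hV0
    (rowSite hd z r j) (η / 2)
  have h1 := measureReal_iInter_le (ρ := 1 - η / 2) (by linarith) (by linarith) hε hmix
    (fun i j hij => le_dist_rowSite hd z r hij) hA (fun j => by
      rw [measureReal_congr (hAe j)]
      exact measureReal_cellWeight_lt_le hV hV0 hη hE _) k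
  refine le_trans (le_of_eq (measureReal_congr ?_)) h1
  have h2 : ∀ᵐ ω ∂P, ∀ j, ω ∈ A j ↔ cellWeight V (rowSite hd z r j) ω < η / 2 :=
    ae_all_iff.2 fun j => (hAe j).mem_iff
  filter_upwards [h2] with ω hω
  refine propext ?_
  change (∀ j < k, _) ↔ ω ∈ ⋂ i ∈ Finset.range k, A i
  simp [hω]

/-- One heavy cell already makes its whole block heavy, so a light block forces all `k` cells to be
light. -/
theorem ofReal_le_lintegral_block (hd : 1 ≤ d) (hV : Measurable (Function.uncurry V))
    (hV0 : ∀ x ω, 0 ≤ V x ω) {z : Fin d → ℤ} {r k m j : ℕ} (hr : 1 ≤ r) (hj : j < k)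
    (hm : k * r ≤ m) {c : ℝ} {ω : Ω} (hc : c ≤ cellWeight V (rowSite hd z r j) ω) :
    ENNReal.ofReal c ≤ ∫⁻ x in block z m, ENNReal.ofReal (1 - Real.exp (-V x ω)) := by
  have hp := isProbabilityMeasure_restrict_block (rowSite hd z r j)
  refine le_trans ?_ (lintegral_mono_set (block_rowSite_subset hd z hr hj hm))
  refine (ENNReal.ofReal_le_ofReal hc).trans ?_
  rw [cellWeight, ofReal_integral_eq_lintegral_ofReal]
  · refine Integrable.of_bound (Measurable.aestronglyMeasurable ?_) 1
      (Eventually.of_forall fun x => ?_)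
    · exact measurable_const.sub (Real.measurable_exp.comp (measurable_sample hV ω).neg)
    · rw [Real.norm_of_nonneg (one_sub_exp_mem_Icc hV0 x ω).1]
      exact (one_sub_exp_mem_Icc hV0 x ω).2
  · exact Eventually.of_forall fun x => (one_sub_exp_mem_Icc hV0 x ω).1

end RandomField

end MultiParticle

-- Choice of scales and union bound

namespace MultiParticle

open Set Filter Topology

theorem tendsto_floor_rpow_atTop {a : ℝ} (ha : 0 < a) :
    Tendsto (fun L : ℝ => ⌊L ^ a⌋₊) atTop atTop :=
  tendsto_nat_floor_atTop.comp (tendsto_rpow_atTop ha)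

/-- A geometric decay rate in `⌊L^a⌋` beats every power of `L`. -/
theorem eventually_rpow_mul_pow_le {a ρ s B : ℝ} (ha : 0 < a) (hρ0 : 0 < ρ) (hρ1 : ρ < 1)
    (hs : 0 ≤ s) (hB : 0 < B) :
    ∀ᶠ L : ℝ in atTop, L ^ s * ((⌊L ^ a⌋₊ + 1 : ℝ) * ρ ^ ⌊L ^ a⌋₊) ≤ B := by
  -- The power `⌈s / a⌉` of `k + 1` absorbs `L^s`, as `L^a ≤ k + 1`; the extra one absorbs the
  -- prefactor `k + 1`.
  set S : ℕ := ⌈s / a⌉₊ + 1 with hS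
  have h1 : Tendsto (fun k : ℕ => ((k : ℝ) + 1) ^ S * ρ ^ k) atTop (𝓝 0) := by
    have h := ((tendsto_pow_const_mul_const_pow_of_abs_lt_one S (r := ρ)
      (by rwa [abs_of_pos hρ0])).comp (tendsto_add_atTop_nat 1)).mul_const ρ⁻¹
    rw [zero_mul] at h
    refine h.congr fun k => ?_
    simp only [Function.comp_apply]
    push_cast
    rw [pow_succ ρ k]
    field_simp
  have h2 : ∀ᶠ L : ℝ in atTop, ((⌊L ^ a⌋₊ : ℝ) + 1) ^ S * ρ ^ ⌊L ^ a⌋₊ < B :=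
    (tendsto_floor_rpow_atTop ha).eventually (h1.eventually_lt_const hB)
  filter_upwards [h2, eventually_ge_atTop 1] with L hL hL1
  refine le_trans ?_ hL.le
  set k : ℕ := ⌊L ^ a⌋₊
  have hk : L ^ a ≤ (k : ℝ) + 1 := (Nat.lt_floor_add_one _).le
  have hLs : L ^ s ≤ ((k : ℝ) + 1) ^ ⌈s / a⌉₊ := by
    calc L ^ s = (L ^ a) ^ (s / a) := by
          rw [← Real.rpow_mul (by linarith), mul_div_cancel₀ _ ha.ne']
      _ ≤ ((k : ℝ) + 1) ^ (s / a) := by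
          refine Real.rpow_le_rpow (Real.rpow_nonneg (by linarith) _) hk (by positivity)
      _ ≤ ((k : ℝ) + 1) ^ ((⌈s / a⌉₊ : ℕ) : ℝ) :=
          Real.rpow_le_rpow_of_exponent_le (by linarith [(Nat.cast_nonneg k : (0 : ℝ) ≤ k)])
            (Nat.le_ceil _)
      _ = _ := Real.rpow_natCast _ _
  calc L ^ s * (((k : ℝ) + 1) * ρ ^ k)
      ≤ ((k : ℝ) + 1) ^ ⌈s / a⌉₊ * (((k : ℝ) + 1) * ρ ^ k) := by gcongr
    _ = _ := by rw [hS, pow_succ]; ring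

theorem eventually_rpow_neg_mul_le {s A B : ℝ} (hs : 0 < s) (hB : 0 < B) :
    ∀ᶠ L : ℝ in atTop, A * L ^ (-s) ≤ B := by
  have h := (tendsto_rpow_neg_atTop hs).const_mul A
  rw [mul_zero] at h
  filter_upwards [h.eventually_lt_const hB] with L hL using hL.le

variable {d : ℕ} {Ω : Type*} [MeasurableSpace Ω] {P : Measure Ω} {V : (Fin d → ℝ) → Ω → ℝ}

/-- The probability of a low ground state energy, for blocks of side `k²` made of `k` cells at
mutual distance `k`. -/
theorem measureReal_groundEnergy_le [IsProbabilityMeasure P] {n : ℕ} (hd : 1 ≤ d) (hn : 0 < n)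
    {Φ : ℝ → ℝ} (hΦm : Measurable Φ) (hΦ : ∀ r : ℝ, 0 ≤ r → 0 ≤ Φ r) {M : ℝ}
    (hM : ∀ r : ℝ, 0 ≤ r → Φ r ≤ M) (hV : Measurable (Function.uncurry V))
    (hloc : ∀ᵐ ω ∂P, LocallyIntegrable fun x => V x ω) (hV0 : ∀ x ω, 0 ≤ V x ω)
    {η : ℝ} (hη : 0 < η) (hη1 : η ≤ 1) (hE : ∀ x, ∫ ω, Real.exp (-V x ω) ∂P ≤ 1 - η)
    {C : ℝ}
    (hmix : ∀ r : ℝ, 0 < r → ∀ S T : Set (Fin d → ℤ), (∀ j ∈ S, ∀ k ∈ T, r ≤ dist j k) →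
      ∀ A B : Set Ω, MeasurableSet[fieldSigma V S] A → MeasurableSet[fieldSigma V T] B →
      |P.real (A ∩ B) - P.real A * P.real B| ≤ Real.exp (-C * r))
    {k : ℕ} (hk : 1 ≤ k) (u : Fin n → Fin d → ℤ) {L : ℝ} (hL : 1 ≤ L) {γ E : ℝ} (hE0 : 0 ≤ E)
    (hEγ : E < γ)
    (hγ : γ * (d * 2 ^ (d + 1) * (k * k : ℕ) ^ (d + 2)) ≤ η / 2) :
    P.real {ω | groundEnergy Φ (fun x => V x ω) u L ≤ (E : EReal)} ≤
      (7 * L) ^ d * ((1 - η / 2) ^ k + k * Real.exp (-C * k)) := by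
  -- A generous range of block indices, independent of `k`; it still gives `2K + 1 ≤ 2L + 5 ≤ 7L`.
  set K : ℕ := ⌈L⌉₊ + 1 with hKdef
  have hK : L + 1 ≤ K * (k * k : ℕ) := by
    have h1 : L + 1 ≤ K := by
      rw [hKdef]; push_cast
      linarith [Nat.le_ceil L]
    have h2 : (1 : ℝ) ≤ (k * k : ℕ) := by exact_mod_cast Nat.mul_pos hk hk
    nlinarith
  set I : Finset (Fin d → ℤ) := Finset.Icc (fun _ => -(K : ℤ)) (fun _ => (K : ℤ)) with hI
  set z : (Fin d → ℤ) → Fin d → ℤ := fun b => u ⟨0, hn⟩ + (k * k) • b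
  set F : (Fin d → ℤ) → Set Ω := fun b =>
    {ω | ∀ j < k, cellWeight V (rowSite hd (z b) k j) ω < η / 2} with hF
  have hFP : ∀ b, P.real (F b) ≤ (1 - η / 2) ^ k + k * Real.exp (-C * k) := fun b =>
    measureReal_forall_cellWeight_lt_le hd hV hV0 hη hη1 hE (Real.exp_pos _).le
      (hmix k (by exact_mod_cast hk)) (z b) k
  -- Off a null set, low energy forces some block to be light. Monotonicity of the outer measure is
  -- enough, so measurability of the energy event is not needed.
  have hsub : ({ω | groundEnergy Φ (fun x => V x ω) u L ≤ (E : EReal)} : Set Ω) ≤ᵐ[P]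
      (⋃ b ∈ I, F b : Set Ω) := by
    filter_upwards [hloc] with ω hω hlow
    change ω ∈ ⋃ b ∈ I, F b
    by_contra hcon
    have hgood : ∀ b ∈ I, ENNReal.ofReal (η / 2) ≤
        ∫⁻ x in block (z b) (k * k), ENNReal.ofReal (1 - Real.exp (-V x ω)) := by
      intro b hb
      have hb' : ω ∉ F b := fun h => hcon (Set.mem_biUnion hb h)
      obtain ⟨j, hj, hle⟩ : ∃ j < k, η / 2 ≤ cellWeight V (rowSite hd (z b) k j) ω := by
        by_contra! h
        exact hb' h
      exact ofReal_le_lintegral_block hd hV hV0 hk hj le_rfl hle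
    have h1 : (γ : EReal) ≤ groundEnergy Φ (fun x => V x ω) u L :=
      le_groundEnergy hd hn (Nat.mul_pos hk hk) (by linarith) hK hΦm hΦ hM
        (measurable_sample hV ω) (fun x => hV0 x ω) hω (hE0.trans_lt hEγ) hγ hgood
    have h2 : (γ : EReal) ≤ (E : EReal) := h1.trans hlow
    exact absurd (EReal.coe_le_coe_iff.1 h2) (not_le.2 hEγ)
  have hcard : (I.card : ℝ) ≤ (7 * L) ^ d := by
    have h1 : I.card = (2 * K + 1) ^ d := by
      rw [hI, Pi.card_Icc]
      simp only [Int.card_Icc, Finset.prod_const, Finset.card_univ, Fintype.card_fin]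
      congr 1
      omega
    rw [h1]
    push_cast
    refine pow_le_pow_left₀ (by positivity) ?_ d
    rw [hKdef]; push_cast
    have := Nat.ceil_lt_add_one (show (0 : ℝ) ≤ L by linarith)
    linarith
  have hB : 0 ≤ (1 - η / 2) ^ k + k * Real.exp (-C * k) :=
    measureReal_nonneg.trans (hFP 0)
  calc P.real {ω | groundEnergy Φ (fun x => V x ω) u L ≤ (E : EReal)}
      ≤ P.real (⋃ b ∈ I, F b) :=
        ENNReal.toReal_mono (measure_ne_top _ _) (measure_mono_ae hsub)
    _ ≤ ∑ b ∈ I, P.real (F b) := measureReal_biUnion_finset_le _ _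
    _ ≤ ∑ _b ∈ I, ((1 - η / 2) ^ k + k * Real.exp (-C * k)) :=
        Finset.sum_le_sum fun b _ => hFP b
    _ = I.card * ((1 - η / 2) ^ k + k * Real.exp (-C * k)) := by
        rw [Finset.sum_const, nsmul_eq_mul]
    _ ≤ _ := mul_le_mul_of_nonneg_right hcard hB

/-- The choice of scales `k = ⌊L^a⌋` makes the block bounds effective. -/
theorem eventually_block_scale (d : ℕ) {η C q : ℝ} (hη : 0 < η) (hη1 : η ≤ 1) (hC : 0 < C)
    (hq : 0 ≤ q) :
    ∀ᶠ L : ℝ in atTop, ∃ k : ℕ, 1 ≤ k ∧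
      2 * L ^ (-(1 / 2) : ℝ) * (d * 2 ^ (d + 1) * (k * k : ℕ) ^ (d + 2)) ≤ η / 2 ∧
      (7 * L) ^ d * ((1 - η / 2) ^ k + k * Real.exp (-C * k)) ≤ L ^ (-q) := by
  -- Then `(k²)^(d+2) ≤ L^(1/4)`, so the energy condition is of order `L^(-1/4)`. The energy level
  -- is `2 L^(-1/2)`, twice the threshold, to make the comparison strict.
  set a : ℝ := 1 / (8 * (d + 2)) with ha
  have ha0 : 0 < a := by positivity
  -- A common rate for the single-cell probability and the mixing error, so that their sum is at
  -- most `(k + 1) ρ^k`.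
  set ρ : ℝ := max (1 - η / 2) (Real.exp (-C)) with hρ
  have hρ0 : 0 < ρ := lt_max_of_lt_right (Real.exp_pos _)
  have hρ1 : ρ < 1 := max_lt (by linarith) (Real.exp_lt_one_iff.2 (by linarith))
  filter_upwards [eventually_ge_atTop 1,
    (tendsto_floor_rpow_atTop ha0).eventually_ge_atTop 1,
    eventually_rpow_mul_pow_le (s := d + q) (B := (7 ^ d)⁻¹) ha0 hρ0 hρ1 (by positivity)
      (by positivity),
    eventually_rpow_neg_mul_le (s := 1 / 4) (A := 2 * (d * 2 ^ (d + 1))) (B := η / 2)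
      (by norm_num) (by positivity)] with L hL1 hk hprob hen
  have hL0 : 0 < L := by linarith
  refine ⟨⌊L ^ a⌋₊, hk, ?_, ?_⟩
  · have h1 : ((⌊L ^ a⌋₊ * ⌊L ^ a⌋₊ : ℕ) : ℝ) ^ (d + 2) ≤ L ^ (1 / 4 : ℝ) := by
      have h2 : (⌊L ^ a⌋₊ : ℝ) ≤ L ^ a := Nat.floor_le (Real.rpow_nonneg hL0.le _)
      calc ((⌊L ^ a⌋₊ * ⌊L ^ a⌋₊ : ℕ) : ℝ) ^ (d + 2) ≤ (L ^ a * L ^ a) ^ (d + 2) := by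
            push_cast
            gcongr
        _ = L ^ (1 / 4 : ℝ) := by
            rw [← Real.rpow_add hL0, ← Real.rpow_natCast, ← Real.rpow_mul hL0.le, ha]
            congr 1
            push_cast
            field_simp
            norm_num
    calc _ ≤ 2 * L ^ (-(1 / 2) : ℝ) * (d * 2 ^ (d + 1) * L ^ (1 / 4 : ℝ)) := by gcongr
      _ = 2 * (d * 2 ^ (d + 1)) * (L ^ (-(1 / 2) : ℝ) * L ^ (1 / 4 : ℝ)) := by ring
      _ = 2 * (d * 2 ^ (d + 1)) * L ^ (-(1 / 4) : ℝ) := by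
          rw [← Real.rpow_add hL0]; norm_num
      _ ≤ _ := hen
  · set k : ℕ := ⌊L ^ a⌋₊
    have h1 : (1 - η / 2) ^ k + k * Real.exp (-C * k) ≤ ((k : ℝ) + 1) * ρ ^ k := by
      have h2 : (1 - η / 2) ^ k ≤ ρ ^ k := pow_le_pow_left₀ (by linarith) (le_max_left _ _) k
      have h3 : Real.exp (-C * k) ≤ ρ ^ k := by
        rw [mul_comm, Real.exp_nat_mul]
        exact pow_le_pow_left₀ (Real.exp_pos _).le (le_max_right _ _) k
      nlinarith [(Nat.cast_nonneg k : (0 : ℝ) ≤ k)]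
    rw [Real.rpow_neg hL0.le, ← one_div, le_div_iff₀ (Real.rpow_pos_of_pos hL0 _)]
    calc (7 * L) ^ d * ((1 - η / 2) ^ k + k * Real.exp (-C * k)) * L ^ q
        ≤ (7 * L) ^ d * (((k : ℝ) + 1) * ρ ^ k) * L ^ q := by gcongr
      _ = 7 ^ d * (L ^ ((d : ℝ) + q) * (((k : ℝ) + 1) * ρ ^ k)) := by
          rw [Real.rpow_add hL0, Real.rpow_natCast, mul_pow]; ring
      _ ≤ 7 ^ d * (7 ^ d)⁻¹ := by gcongr
      _ = 1 := mul_inv_cancel₀ (by positivity)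

end MultiParticle

theorem theorem2p3 (N d : ℕ) (hN : 2 ≤ N) (hd : 1 ≤ d)
    {Ω : Type*} [MeasurableSpace Ω] (P : Measure Ω) [IsProbabilityMeasure P]
    (Φ : ℝ → ℝ) (hΦ_meas : Measurable Φ) (hΦ_nonneg : ∀ r : ℝ, 0 ≤ r → 0 ≤ Φ r)
    (hΦ_bdd : ∃ M : ℝ, ∀ r : ℝ, 0 ≤ r → Φ r ≤ M)
    (V : (Fin d → ℝ) → Ω → ℝ) (hV_meas : Measurable (Function.uncurry V))
    (hV_loc : ∀ᵐ ω ∂P, LocallyIntegrable (fun x => V x ω))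
    (hV_nonneg : ∀ x ω, 0 ≤ V x ω)
    (hV_nondeg : ∃ s₀ : ℝ, 0 < s₀ ∧
      ∀ x, s₀ ≤ -(1 / 2) * Real.log (∫ ω, Real.exp (-V x ω) ∂P))
    (hV_mix : MultiParticle.StronglyMixing P V)
    (p : ℝ) (hp : 0 < p) :
    ∃ L₁ : ℝ, 0 < L₁ ∧ ∀ n : ℕ, 1 ≤ n → n ≤ N → ∀ (u : Fin n → Fin d → ℤ) (L : ℝ), L₁ ≤ L →
      P.real {ω | MultiParticle.groundEnergy Φ (fun x => V x ω) u L
          ≤ ((L ^ (-(1 / 2) : ℝ) : ℝ) : EReal)}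
        ≤ L ^ (-(2 * p * 4 ^ (N - n)) : ℝ) := by
  obtain ⟨M, hM⟩ := hΦ_bdd
  obtain ⟨s₀, hs₀, hs⟩ := hV_nondeg
  obtain ⟨C, hC, hmix⟩ := hV_mix
  have hη1 : 1 - Real.exp (-2 * s₀) ≤ 1 := by linarith [Real.exp_pos (-2 * s₀)]
  have hη : 0 < 1 - Real.exp (-2 * s₀) := by
    linarith [Real.exp_lt_one_iff.2 (show -2 * s₀ < 0 by linarith)]
  have hE : ∀ x, ∫ ω, Real.exp (-V x ω) ∂P ≤ 1 - (1 - Real.exp (-2 * s₀)) := fun x => by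
    rw [sub_sub_cancel]
    have h0 : 0 ≤ ∫ ω, Real.exp (-V x ω) ∂P := integral_nonneg fun ω => (Real.exp_pos _).le
    -- Removing the logarithm requires a positive expectation; a vanishing one satisfies the bound
    -- trivially.
    rcases h0.eq_or_lt with h | h
    · rw [← h]
      exact (Real.exp_pos _).le
    · rw [← Real.log_le_iff_le_exp h]
      linarith [hs x]
  -- The exponent with `4^N` dominates those with `4^(N - n)`, so for `L ≥ 1` one threshold serves
  -- all `n` and `u`.
  obtain ⟨L₀, hL₀⟩ := Filter.eventually_atTop.1
    (MultiParticle.eventually_block_scale d (q := 2 * p * 4 ^ N) hη hη1 hC (by positivity))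
  refine ⟨max 1 L₀, by positivity, fun n hn hnN u L hL => ?_⟩
  have hL1 : 1 ≤ L := (le_max_left _ _).trans hL
  have hLpos : 0 < L := by linarith
  obtain ⟨k, hk, hγ, hprob⟩ := hL₀ L ((le_max_right _ _).trans hL)
  have hpos : 0 < L ^ (-(1 / 2) : ℝ) := Real.rpow_pos_of_pos hLpos _
  refine (MultiParticle.measureReal_groundEnergy_le hd hn hΦ_meas hΦ_nonneg hM hV_meas hV_loc
    hV_nonneg hη hη1 hE hmix hk u hL1 hpos.le (by linarith) hγ).trans (hprob.trans ?_)
  refine Real.rpow_le_rpow_of_exponent_le hL1 (neg_le_neg ?_)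
  gcongr
  · norm_num
  · exact Nat.sub_le N n
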